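/- Throughout, a tree is a structure $T=(V;\le)$ where $\le$ is a partial order on $V$ with a least element such that for every $x\in V$ the set $\{y\mid y\le x\}$ is finite and linearly ordered by $\le$. The level of $x$ is $|\{y \mid y<x\}|$, and the height of $T$ is the supremum of the levels of its nodes. An automatic presentation of a structure $(D;R)$ with one binary relation $R\subseteq D\times D$ is a pair of non-deterministic finite automata, one accepting the domain $D$, which is a set of words over a finite alphabet, and the other accepting the set of convolutions $\{u\otimes v\mid (u,v)\in R\}$; here $u\otimes v$ is the word of length $\max(|u|,|v|)$ whose $i$-th symbol is the pair of the $i$-th symbols of $u$ and $v$, the shorter word being padded with a symbol $\diamond$ outside the alphabet. The structure presented by $P$ is denoted $\mathcal S(P)$. For $n\ge 1$, the isomorphism problem for automatic trees of height at most $n$ is the set of all pairs $(P_1,P_2)$ of automatic presentations such that $\mathcal S(P_1)\cong\mathcal S(P_2)$ and $\mathcal S(P_2)$ is a tree of height at most $n$. Presentations are encoded effectively by natural numbers; a set belongs to $\Sigma^0_m$ if it has the form $\{a\mid \exists x_1\,\forall x_2\cdots Q x_m:\ (a,x_1,\dots,x_m)\in P\}$ with $P$ recursive, alternating quantifiers over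 $\mathbb N$, and $Q=\exists$ for odd $m$, $Q=\forall$ for even $m$; the complements of $\Sigma^0_m$-sets are the $\Pi^0_m$-sets. Proposition. The isomorphism problem for automatic trees of height at most $n$ is decidable for $n=1$, and it belongs to $\Pi^0_{2n-3}$ for every $n\ge 2$. -/

import Mathlib

namespace AutomaticTrees

/-! ### The arithmetical hierarchy -/

/-- `altQuant b m R` is the statement `Q₁ x₁ Q₂ x₂ ⋯ Qₘ xₘ : R (x₁, …, xₘ)` over the natural numbers
with alternating quantifiers, `Q₁` being `∃` if `b = true` and `∀` if `b = false`. -/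
def altQuant : Bool → (m : ℕ) → (List.Vector ℕ m → Prop) → Prop
  | _, 0, R => R List.Vector.nil
  | true, m + 1, R => ∃ x, altQuant false m fun v => R (x ::ᵥ v)
  | false, m + 1, R => ∀ x, altQuant true m fun v => R (x ::ᵥ v)

/-- `A` belongs to `Σ⁰ₘ`: there is a recursive predicate `P` with
`A = {a | ∃ x₁ ∀ x₂ ⋯ Q xₘ : P (a, x₁, …, xₘ)}`.  The elements of `A` are natural numbers or, more
generally, objects with an effective encoding by natural numbers. -/
def IsSigma {α : Type} [Primcodable α] (m : ℕ) (A : Set α) : Prop :=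
  ∃ P : α × List.Vector ℕ m → Prop, ComputablePred P ∧
    ∀ a, a ∈ A ↔ altQuant true m fun v => P (a, v)

/-- `A` belongs to `Π⁰ₘ`: its complement belongs to `Σ⁰ₘ`. -/
def IsPi {α : Type} [Primcodable α] (m : ℕ) (A : Set α) : Prop :=
  IsSigma m Aᶜ

/-- `A` is decidable. -/
def IsDecidable {α : Type} [Primcodable α] (A : Set α) : Prop :=
  ComputablePred fun a => a ∈ A

/-! ### Finite automata as finite objects -/

/-- A non-deterministic finite automaton with letters in `α`, given by the finite lists of its
transitions `(p, a, q)`, initial states and accepting states.  States are named by natural numbers;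
only finitely many states and letters occur in an automaton. -/
structure FinAut (α : Type) where
  trans : List (ℕ × α × ℕ)
  init : List ℕ
  final : List ℕ

/-- A finite automaton is the tuple of its components. -/
def FinAut.equivProd (α : Type) : FinAut α ≃ List (ℕ × α × ℕ) × List ℕ × List ℕ where
  toFun A := (A.trans, A.init, A.final)
  invFun t := ⟨t.1, t.2.1, t.2.2⟩
  left_inv _ := rfl
  right_inv _ := rfl

instance (α : Type) [Primcodable α] : Primcodable (FinAut α) :=
  Primcodable.ofEquiv _ (FinAut.equivProd α)

/-- The automaton as an `NFA` of Mathlib. -/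
def FinAut.toNFA {α : Type} (A : FinAut α) : NFA α ℕ where
  step p a := {q | (p, a, q) ∈ A.trans}
  start := {q | q ∈ A.init}
  accept := {q | q ∈ A.final}

/-- The language `L(A)` accepted by `A`. -/
def FinAut.language {α : Type} (A : FinAut α) : Language α :=
  A.toNFA.accepts

/-! ### Automatic presentations -/

/-- The convolution `u ⊗ v` of two words: its length is `max |u| |v|`, and its `i`-th symbol is the
pair of the `i`-th symbols of `u` and of `v`, where `none` is the padding symbol `⋄`. -/
def conv (u v : List ℕ) : List (Option ℕ × Option ℕ) :=
  (List.range (max u.length v.length)).map fun i => (u[i]?, v[i]?)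

/-- A pair of a finite automaton for the domain and a synchronous two-tape finite automaton for the
binary relation of a structure.  The letters of words are named by natural numbers, finitely many of
which occur in the automata. -/
structure Presentation where
  dom : FinAut ℕ
  rel : FinAut (Option ℕ × Option ℕ)

/-- A presentation is the pair of its automata. -/
def Presentation.equivProd : Presentation ≃ FinAut ℕ × FinAut (Option ℕ × Option ℕ) where
  toFun P := (P.dom, P.rel)
  invFun t := ⟨t.1, t.2⟩
  left_inv _ := rfl
  right_inv _ := rfl

instance : Primcodable Presentation :=
  Primcodable.ofEquiv _ Presentation.equivProd

/-- `P` is an automatic presentation: the second automaton recognizes the set of convolutions of the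
pairs in a binary relation on the domain, i.e. it accepts nothing but convolutions of two words of
the domain. -/
def Presentation.IsAutomatic (P : Presentation) : Prop :=
  ∀ w ∈ P.rel.language, ∃ u ∈ P.dom.language, ∃ v ∈ P.dom.language, w = conv u v

/-- The domain of the structure `S(P)`: the set of words accepted by the first automaton. -/
def Presentation.Dom (P : Presentation) : Type :=
  {w : List ℕ // w ∈ P.dom.language}

/-- The binary relation of the structure `S(P)`. -/
def Presentation.Rel (P : Presentation) (u v : P.Dom) : Prop :=
  conv u.1 v.1 ∈ P.rel.language

/-- The isomorphism problem for a class `K` of structures with one binary relation: the set of pairs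
`(P₁, P₂)` of automatic presentations with `S(P₁) ≅ S(P₂) ∈ K`. -/
def isoProblem (K : (D : Type) → (D → D → Prop) → Prop) : Set (Presentation × Presentation) :=
  {p | p.1.IsAutomatic ∧ p.2.IsAutomatic ∧ Nonempty (p.1.Rel ≃r p.2.Rel) ∧ K p.2.Dom p.2.Rel}

/-! ### Trees -/

/-- `(V; r)` is a tree: `r` is a partial order with a least element, and for every `x` the set of
ancestors `{y | r y x}` is finite and linearly ordered by `r`. -/
structure IsTree {V : Type} (r : V → V → Prop) : Prop where
  refl : ∀ x, r x x
  antisymm : ∀ x y, r x y → r y x → x = y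
  trans : ∀ x y z, r x y → r y z → r x z
  root : ∃ o, ∀ x, r o x
  finite : ∀ x, {y | r y x}.Finite
  linear : ∀ x y z, r y x → r z x → r y z ∨ r z y

/-- The level of a node `x`: the number of nodes strictly below `x`. -/
noncomputable def level {V : Type} (r : V → V → Prop) (x : V) : ℕ∞ :=
  {y | r y x ∧ y ≠ x}.encard

/-- The height of a tree: the supremum of the levels of its nodes. -/
noncomputable def height {V : Type} (r : V → V → Prop) : ℕ∞ :=
  ⨆ x, level r x

/-- The class of trees of height at most `n`. -/
def TreeOfHeightLE (n : ℕ) (V : Type) (r : V → V → Prop) : Prop :=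
  IsTree r ∧ height r ≤ n

end AutomaticTrees

/-!
A language over a finite alphabet with at most `N` left quotients is infinite if and only if it
contains a word of length in `[N, 2 * N)`, and otherwise all of its words are shorter than `N`.
Bounds for the number of quotients, unlike automata, pass easily through Boolean operations and
counting quantifiers such as "exactly `c` words `u` satisfy `(u, v) ∈ R`". Hence in automatic
presentations the numbers of ancestors, of descendants, and of the children with a given number of
descendants are computable as elements of `ℕ∞`.

A tree of height at most one is determined by the number of its nodes, and a tree of height at most
`k + 2` by the numbers of children of its root whose subtrees have each given isomorphism invariant.
Two trees of height at most two are thus non-isomorphic if and only if, for some `N : ℕ∞`, their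
roots have different numbers of children with `N` descendants, a `Σ₁` condition. For larger heights,
some child `w` and some `l : ℕ` witness a difference: on one side, but not on the other, there are
`l` distinct children having the invariant of `w`. Each level of the tree therefore adds two
quantifiers.
-/

namespace AutomaticTrees

attribute [fun_prop] Primrec Primrec.id Primrec.const Primrec.comp Primrec.pair Primrec.fst
  Primrec.snd Primrec.unpair Primrec.encode Primrec.option_some Primrec.list_length
  Primrec.list_range PrimrecPred PrimrecPred.not PrimrecPred.and PrimrecPred.or

/-! ### Predicates in prenex normal form -/

/-- The class of `Σ⁰ₘ` predicates with a primitive recursive matrix; each step `∃ x, ¬ q (a, x)`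
contributes one quantifier. -/
def SigmaPred : ℕ → ∀ {α : Type} [Primcodable α], (α → Prop) → Prop
  | 0, _, _, p => PrimrecPred p
  | m + 1, α, _, p => ∃ q : α × ℕ → Prop, SigmaPred m q ∧ ∀ a, p a ↔ ∃ x, ¬ q (a, x)

namespace SigmaPred

variable {α β : Type} [Primcodable α] [Primcodable β] {m : ℕ} {p q : α → Prop}

theorem of_eq (hp : SigmaPred m p) (h : ∀ a, p a ↔ q a) : SigmaPred m q :=
  (funext fun a => propext (h a) : p = q) ▸ hp

theorem comp {p : β → Prop} {f : α → β} (hp : SigmaPred m p) (hf : Primrec f) :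
    SigmaPred m fun a => p (f a) := by
  induction m generalizing α β with
  | zero => exact PrimrecPred.comp hp hf
  | succ m ih =>
    obtain ⟨q, hq, h⟩ := hp
    exact ⟨fun a => q (f a.1, a.2), ih hq (by fun_prop), fun a => h (f a)⟩

theorem of_not (hp : SigmaPred m fun a => ¬ p a) : SigmaPred (m + 1) p :=
  ⟨_, hp.comp .fst, fun a => by simp⟩

theorem succ (hp : SigmaPred m p) : SigmaPred (m + 1) p := by
  induction m generalizing α with
  | zero => exact of_not (PrimrecPred.not hp)
  | succ m ih => exact hp.imp fun _ h => ⟨ih h.1, h.2⟩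

theorem mono {n : ℕ} (hp : SigmaPred m p) (h : m ≤ n) : SigmaPred n p := by
  induction h with
  | refl => exact hp
  | step _ ih => exact ih.succ

theorem of_primrecPred (hp : PrimrecPred p) : SigmaPred m p :=
  mono (m := 0) hp m.zero_le

theorem and_or (hp : SigmaPred m p) (hq : SigmaPred m q) :
    (SigmaPred m fun a => p a ∧ q a) ∧ SigmaPred m fun a => p a ∨ q a := by
  induction m generalizing α with
  | zero => exact ⟨PrimrecPred.and hp hq, PrimrecPred.or hp hq⟩
  | succ m ih =>
    obtain ⟨p', hp', h⟩ := hp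
    obtain ⟨q', hq', h'⟩ := hq
    constructor
    · refine ⟨_, (ih (hp'.comp (f := fun a : α × ℕ => (a.1, a.2.unpair.1)) (by fun_prop))
        (hq'.comp (f := fun a : α × ℕ => (a.1, a.2.unpair.2)) (by fun_prop))).2, fun a => ?_⟩
      simp only [h, h', not_or]
      exact ⟨fun ⟨⟨x, hx⟩, y, hy⟩ => ⟨Nat.pair x y, by simp [hx, hy]⟩,
        fun ⟨_, hx, hy⟩ => ⟨⟨_, hx⟩, _, hy⟩⟩
    · refine ⟨_, (ih hp' hq').1, fun a => ?_⟩
      simp only [h, h', not_and_or, exists_or]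

theorem and (hp : SigmaPred m p) (hq : SigmaPred m q) : SigmaPred m fun a => p a ∧ q a :=
  (and_or hp hq).1

theorem or (hp : SigmaPred m p) (hq : SigmaPred m q) : SigmaPred m fun a => p a ∨ q a :=
  (and_or hp hq).2

theorem exists_nat {p : α → ℕ → Prop} (hp : SigmaPred (m + 1) fun x : α × ℕ => p x.1 x.2) :
    SigmaPred (m + 1) fun a => ∃ x, p a x := by
  obtain ⟨q, hq, h⟩ := hp
  refine ⟨_, hq.comp (f := fun a : α × ℕ => ((a.1, a.2.unpair.1), a.2.unpair.2)) (by fun_prop),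
    fun a => ?_⟩
  constructor
  · rintro ⟨x, hx⟩
    obtain ⟨y, hy⟩ := (h (a, x)).1 hx
    exact ⟨Nat.pair x y, by simpa using hy⟩
  · exact fun ⟨_, hx⟩ => ⟨_, (h (a, _)).2 ⟨_, hx⟩⟩

theorem exists_of [Inhabited β] {p : α × β → Prop} (hp : SigmaPred (m + 1) p) :
    SigmaPred (m + 1) fun a => ∃ x, p (a, x) := by
  have hdec : Primrec fun x : α × ℕ => (x.1, (Encodable.decode (α := β) x.2).getD default) :=
    Primrec.fst.pair (Primrec.option_getD.comp (Primrec.decode.comp .snd) (.const _))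
  refine (exists_nat (p := fun a n => p (a, (Encodable.decode n).getD default))
    (hp.comp hdec)).of_eq fun a => ?_
  exact ⟨fun ⟨_, hx⟩ => ⟨_, hx⟩, fun ⟨x, hx⟩ => ⟨Encodable.encode x, by simpa using hx⟩⟩

theorem of_not_forall [Inhabited β] {p : α → β → Prop}
    (hp : PrimrecPred fun x : α × β => p x.1 x.2) : SigmaPred 1 fun a => ¬ ∀ x, p a x := by
  simp only [not_forall]
  exact exists_of (of_primrecPred hp.not)

end SigmaPred

theorem altQuant_not (b : Bool) (m : ℕ) (R : List.Vector ℕ m → Prop) :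
    altQuant b m (fun v => ¬ R v) ↔ ¬ altQuant (!b) m R := by
  induction m generalizing b with
  | zero => simp [altQuant]
  | succ m ih => cases b <;> simp [altQuant, ih]

theorem SigmaPred.isSigma {α : Type} [Primcodable α] {m : ℕ} {A : Set α}
    (h : SigmaPred m (· ∈ A)) : IsSigma m A := by
  induction m generalizing α with
  | zero => exact ⟨fun a => a.1 ∈ A, (PrimrecPred.comp h .fst).computablePred, fun a => Iff.rfl⟩
  | succ m ih =>
    obtain ⟨q, hq, h⟩ := h
    obtain ⟨P, hP, hPq⟩ := ih (A := {a | q a}) hq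
    have hsplit : Primrec fun a : α × List.Vector ℕ (m + 1) => ((a.1, a.2.head), a.2.tail) :=
      (Primrec.fst.pair (Primrec.vector_head.comp .snd)).pair (Primrec.vector_tail.comp .snd)
    refine ⟨fun a => ¬ P ((a.1, a.2.head), a.2.tail), ?_, fun a => ?_⟩
    · obtain ⟨f, hf, rfl⟩ := ComputablePred.computable_iff.1 hP
      exact ComputablePred.not (ComputablePred.computable_iff.2 ⟨_, hf.comp hsplit.to_comp, rfl⟩)
    · refine (h a).trans (exists_congr fun x => ?_)
      exact (not_congr (hPq (a, x))).trans (altQuant_not false m _).symm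

attribute [irreducible] SigmaPred

/-! ### Primitive recursion -/

section Primrec

variable {α β : Type} [Primcodable α] [Primcodable β]

@[fun_prop]
theorem primrec_add : Primrec fun x : ℕ × ℕ => x.1 + x.2 := Primrec.nat_add

@[fun_prop]
theorem primrec_mul : Primrec fun x : ℕ × ℕ => x.1 * x.2 := Primrec.nat_mul

@[fun_prop]
theorem primrec_pow : Primrec fun x : ℕ × ℕ => x.1 ^ x.2 :=
  Primrec₂.unpaired'.1 Nat.Primrec.pow

@[fun_prop]
theorem primrecPred_eq {f g : α → β} (hf : Primrec f) (hg : Primrec g) :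
    PrimrecPred fun a => f a = g a :=
  Primrec.eq.comp hf hg

@[fun_prop]
theorem primrecPred_le {f g : α → ℕ} (hf : Primrec f) (hg : Primrec g) :
    PrimrecPred fun a => f a ≤ g a :=
  Primrec.nat_le.comp hf hg

@[fun_prop]
theorem primrecPred_imp {p q : α → Prop} (hp : PrimrecPred p) (hq : PrimrecPred q) :
    PrimrecPred fun a => p a → q a :=
  (hp.not.or hq).of_eq fun _ => imp_iff_not_or.symm

theorem primrecRel_swap {p : α → β → Prop} (hp : PrimrecPred fun x : α × β => p x.1 x.2) :
    PrimrecRel fun b a => p a b :=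
  PrimrecPred.comp hp (f := fun x : β × α => (x.2, x.1)) (by fun_prop)

theorem primrecPred_exists_mem {l : α → List β} {p : α → β → Prop} (hl : Primrec l)
    (hp : PrimrecPred fun x : α × β => p x.1 x.2) : PrimrecPred fun a => ∃ b ∈ l a, p a b :=
  (primrecRel_swap hp).exists_mem_list.comp hl .id

theorem primrecPred_forall_mem {l : α → List β} {p : α → β → Prop} (hl : Primrec l)
    (hp : PrimrecPred fun x : α × β => p x.1 x.2) : PrimrecPred fun a => ∀ b ∈ l a, p a b :=
  (primrecRel_swap hp).forall_mem_list.comp hl .id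

@[fun_prop]
theorem primrecPred_mem {l : α → List β} {f : α → β} (hl : Primrec l) (hf : Primrec f) :
    PrimrecPred fun a => f a ∈ l a :=
  (primrecPred_exists_mem (p := fun a b => b = f a) hl (by fun_prop)).of_eq fun a => by simp

theorem primrec_filter {l : α → List β} {p : α → β → Prop} [∀ a, DecidablePred (p a)]
    (hl : Primrec l) (hp : PrimrecPred fun x : α × β => p x.1 x.2) :
    Primrec fun a => (l a).filter (p a ·) :=
  (primrecRel_swap hp).listFilter.comp hl .id

/-- Extended natural numbers as optional natural numbers, with `none` for `⊤`. -/
def enatEquiv : ℕ∞ ≃ Option ℕ := Equiv.refl _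

instance : Primcodable ℕ∞ :=
  Primcodable.ofEquiv _ enatEquiv

@[fun_prop]
theorem primrec_natCast : Primrec fun n : ℕ => (n : ℕ∞) :=
  (Primrec.of_equiv_iff enatEquiv).1 Primrec.option_some

@[fun_prop]
theorem primrec_toNat : Primrec ENat.toNat :=
  (Primrec.option_getD.comp (Primrec.of_equiv (e := enatEquiv)) (.const 0)).of_eq
    fun n => by cases n <;> rfl

@[fun_prop]
theorem primrec_enat_add_one : Primrec fun n : ℕ∞ => n + 1 :=
  (Primrec.of_equiv_iff enatEquiv).1 ((Primrec.option_map Primrec.of_equiv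
    (Primrec.succ.comp .snd).to₂).of_eq fun n => by cases n <;> rfl)

theorem primrecPred_le_natCast {f : α → ℕ∞} {g : α → ℕ} (hf : Primrec f) (hg : Primrec g) :
    PrimrecPred fun a => f a ≤ g a := by
  refine ((Primrec.eq.comp hf (.const ⊤)).not.and
    (Primrec.nat_le.comp (primrec_toNat.comp hf) hg)).of_eq fun a => ?_
  induction f a using ENat.recTopCoe <;> simp

/-- The list of all elements with code at most `c`. -/
def codesLE (β : Type) [Primcodable β] (c : ℕ) : List β :=
  (List.range (c + 1)).filterMap (Encodable.decode₂ β)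

theorem mem_codesLE {c : ℕ} {b : β} : b ∈ codesLE β c ↔ Encodable.encode b ≤ c := by
  simp only [codesLE, List.mem_filterMap, List.mem_range, Encodable.decode₂_eq_some]
  exact ⟨by rintro ⟨n, hn, rfl⟩; omega, fun h => ⟨_, by omega, rfl⟩⟩

theorem nodup_codesLE (c : ℕ) : (codesLE β c).Nodup := by
  refine List.Nodup.filterMap (fun a a' b h h' => ?_) List.nodup_range
  rw [Option.mem_def, Encodable.decode₂_eq_some] at h h'
  exact h.symm.trans h'

@[fun_prop]
theorem primrec_codesLE : Primrec (codesLE β) :=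
  Primrec.listFilterMap (by fun_prop) (Primrec.decode₂.comp .snd).to₂

/-- A bound for the codes of words of length at most `n` over letters with codes at most `B`. -/
def codeBound (B n : ℕ) : ℕ :=
  Nat.rec 0 (fun _ c => Nat.pair B c + 1) n

@[fun_prop]
theorem primrec_codeBound : Primrec fun x : ℕ × ℕ => codeBound x.1 x.2 :=
  Primrec.nat_rec (.const 0) (Primrec.succ.comp (Primrec₂.natPair.comp .fst
    (Primrec.snd.comp .snd))).to₂

theorem pair_le_pair {a b c d : ℕ} (h : a ≤ b) (h' : c ≤ d) : Nat.pair a c ≤ Nat.pair b d :=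
  ((StrictMono.monotone fun _ _ h => Nat.pair_lt_pair_left c h) h).trans
    ((StrictMono.monotone fun _ _ h => Nat.pair_lt_pair_right b h) h')

theorem encode_le_codeBound {B n : ℕ} {w : List β} (h : w.length ≤ n)
    (hB : ∀ b ∈ w, Encodable.encode b ≤ B) : Encodable.encode w ≤ codeBound B n := by
  induction w generalizing n with
  | nil => simp
  | cons a w ih =>
    obtain _ | n := n
    · simp at h
    · rw [Encodable.encode_list_cons]
      exact Nat.succ_le_succ (pair_le_pair (hB _ (by simp))
        (ih (by simpa using h) fun b hb => hB _ (by simp [hb])))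

theorem encode_le_of_mem {b : β} {l : List β} (h : b ∈ l) :
    Encodable.encode b ≤ Encodable.encode l := by
  induction l with
  | nil => simp at h
  | cons a l ih =>
    rw [Encodable.encode_list_cons]
    rcases List.mem_cons.1 h with rfl | h
    · exact (Nat.left_le_pair _ _).trans (Nat.le_succ _)
    · exact (ih h).trans ((Nat.right_le_pair _ _).trans (Nat.le_succ _))

end Primrec

/-! ### Languages with few quotients -/

section FewQuotients

variable {β γ σ : Type} {S T : Set (List β)} {N M : ℕ}

/-- The language `S` has at most `N` left quotients `{z | x ++ z ∈ S}`, i.e. its minimal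
deterministic automaton has at most `N` states. -/
def FewQuotients (S : Set (List β)) (N : ℕ) : Prop :=
  (Set.range (Language.leftQuotient S)).encard ≤ N

namespace FewQuotients

theorem of_coloring (f : List β → σ) (hf : (Set.range f).encard ≤ N)
    (h : ∀ x y, f x = f y → ∀ z, x ++ z ∈ S → y ++ z ∈ S) : FewQuotients S N := by
  have hrep : ∀ L ∈ Set.range (Language.leftQuotient S), ∃ x, Language.leftQuotient S x = L :=
    fun L hL => hL
  choose! rep hrep using hrep
  refine (Set.encard_le_encard_of_injOn (f := f ∘ rep) (fun L _ => Set.mem_range_self (rep L))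
    fun L hL L' hL' hfL => ?_).trans hf
  rw [← hrep L hL, ← hrep L' hL']
  ext z
  exact ⟨h _ _ hfL z, h _ _ hfL.symm z⟩

theorem mono (h : FewQuotients S N) (hN : N ≤ M) : FewQuotients S M :=
  h.trans (Nat.cast_le.2 hN)

theorem compl (h : FewQuotients S N) : FewQuotients Sᶜ N :=
  of_coloring (Language.leftQuotient S) h fun _ _ hxy _ hx hy => hx (hxy.ge hy)

theorem inter (h : FewQuotients S N) (h' : FewQuotients T M) : FewQuotients (S ∩ T) (N * M) := by
  refine of_coloring (fun x => (Language.leftQuotient S x, Language.leftQuotient T x)) ?_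
    fun x y hxy z hz => ?_
  · refine (Set.encard_le_encard (Set.range_subset_iff.2 fun x =>
      Set.mk_mem_prod (Set.mem_range_self x) (Set.mem_range_self x))).trans ?_
    rw [Set.encard_prod, Nat.cast_mul]
    exact mul_le_mul' h h'
  · rw [Prod.mk.injEq] at hxy
    exact ⟨hxy.1.le hz.1, hxy.2.le hz.2⟩

theorem preimage {S : Set (List γ)} (h : FewQuotients S N) {φ : List β → List γ}
    (hφ : ∀ x y, φ (x ++ y) = φ x ++ φ y) : FewQuotients (φ ⁻¹' S) N := by
  refine of_coloring (Language.leftQuotient S ∘ φ)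
    ((Set.encard_le_encard (Set.range_comp_subset_range _ _)).trans h) fun x y hxy z hz => ?_
  rw [Set.mem_preimage, hφ] at hz ⊢
  exact hxy.le hz

theorem leftQuotient (h : FewQuotients S N) (x : List β) :
    FewQuotients (Language.leftQuotient S x) N := by
  refine (Set.encard_le_encard ?_).trans h
  rintro _ ⟨y, rfl⟩
  exact ⟨x ++ y, Language.leftQuotient_append _ _ _⟩

theorem exists_split (h : FewQuotients S N) {w : List β} (hw : w ∈ S) (hl : N ≤ w.length) :
    ∃ x y z, w = x ++ y ++ z ∧ 0 < y.length ∧ y.length ≤ N ∧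
      ∀ k, x ++ (List.replicate k y).flatten ++ z ∈ S := by
  let K : Language β := S
  have : Fintype (Set.range K.leftQuotient) := (Set.finite_of_encard_le_coe h).fintype
  have hcard : Fintype.card (Set.range K.leftQuotient) ≤ N := by
    rw [← Nat.cast_le (α := ℕ∞), Set.coe_fintypeCard]
    exact h
  have hwK : w ∈ K.toDFA.accepts := by rwa [Language.accepts_toDFA]
  obtain ⟨x, y, z, rfl, hlen, hy, hpump⟩ := K.toDFA.pumping_lemma hwK (hcard.trans hl)
  refine ⟨x, y, z, rfl, List.length_pos_iff.2 hy, by omega, fun k => ?_⟩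
  change _ ∈ K
  rw [← K.accepts_toDFA]
  exact hpump (Language.append_mem_mul (Language.append_mem_mul rfl
    (Language.join_mem_kstar fun v hv => List.eq_of_mem_replicate hv)) rfl)

theorem infinite (h : FewQuotients S N) {w : List β} (hw : w ∈ S) (hl : N ≤ w.length) :
    S.Infinite := by
  obtain ⟨x, y, z, -, hy, -, hk⟩ := h.exists_split hw hl
  refine Set.infinite_of_injective_forall_mem (fun k l hkl => ?_) hk
  have hlen := congrArg List.length hkl
  simp only [List.length_append, List.length_flatten, List.map_replicate, List.sum_replicate,
    smul_eq_mul] at hlen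
  exact Nat.eq_of_mul_eq_mul_right hy (by omega)

theorem exists_length_lt (h : FewQuotients S N) {w : List β} (hw : w ∈ S) (hl : N ≤ w.length) :
    ∃ w' ∈ S, N ≤ w'.length ∧ w'.length < 2 * N := by
  induction hn : w.length using Nat.strong_induction_on generalizing w with
  | _ n ih =>
    subst hn
    by_cases hlt : w.length < 2 * N
    · exact ⟨w, hw, hl, hlt⟩
    · obtain ⟨x, y, z, rfl, hy, hyN, hk⟩ := h.exists_split hw hl
      have hxz : x ++ z ∈ S := by simpa using hk 0
      simp only [List.length_append] at hlt ih
      exact ih _ (by simp only [List.length_append]; omega) hxz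
        (by simp only [List.length_append]; omega) rfl

theorem length_lt (h : FewQuotients S N) (hS : S.Finite) {w : List β} (hw : w ∈ S) :
    w.length < N :=
  not_le.1 fun hl => h.infinite hw hl hS

end FewQuotients

theorem finite_of_bounded [Encodable β] {B n : ℕ} (hB : ∀ w ∈ S, ∀ b ∈ w, Encodable.encode b ≤ B)
    (hn : ∀ w ∈ S, w.length ≤ n) : S.Finite := by
  have hletters : {b : β | Encodable.encode b ≤ B}.Finite :=
    Set.Finite.preimage Encodable.encode_injective.injOn (Set.finite_Iic B)
  have : Finite {b : β // Encodable.encode b ≤ B} := hletters.to_subtype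
  refine ((List.finite_length_le {b : β // Encodable.encode b ≤ B} n).image
    (List.map Subtype.val)).subset fun w hw => ?_
  exact ⟨w.attachWith _ (hB w hw), by simpa using hn w hw, by simp⟩

end FewQuotients

/-! ### Uniformly regular families of languages -/

section RegularFamily

variable {α β γ : Type} [Primcodable α] [Primcodable β] [Primcodable γ]
  {p q : α → List β → Prop}

/-- The languages `{w | p a w}` are regular uniformly in `a`: the words are decided, and the numbers
of left quotients are bounded, by primitive recursive functions of `a`. -/
structure RegularFamily (p : α → List β → Prop) : Prop where
  primrecPred : PrimrecPred fun x : α × List β => p x.1 x.2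
  fewQuotients : ∃ N : α → ℕ, Primrec N ∧ ∀ a, FewQuotients {w | p a w} (N a)

/-- The codes of the letters in the words of `{w | p a w}` are bounded primitive recursively. -/
def LettersBounded (p : α → List β → Prop) : Prop :=
  ∃ B : α → ℕ, Primrec B ∧ ∀ a w, p a w → ∀ b ∈ w, Encodable.encode b ≤ B a

theorem LettersBounded.mono (hq : LettersBounded q) (h : ∀ a w, p a w → q a w) :
    LettersBounded p :=
  hq.imp fun _ hB => ⟨hB.1, fun a w hw => hB.2 a w (h a w hw)⟩

theorem LettersBounded.comp (hp : LettersBounded p) {f : γ → α} (hf : Primrec f) :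
    LettersBounded fun c => p (f c) := by
  obtain ⟨B, hB, h⟩ := hp
  exact ⟨B ∘ f, hB.comp hf, fun c => h (f c)⟩

namespace RegularFamily

theorem comp (hp : RegularFamily p) {f : γ → α} (hf : Primrec f) :
    RegularFamily fun c => p (f c) := by
  obtain ⟨hp, N, hN, h⟩ := hp
  exact ⟨hp.comp (f := fun x : γ × List β => (f x.1, x.2)) (by fun_prop), N ∘ f,
    hN.comp hf, fun c => h (f c)⟩

theorem not (hp : RegularFamily p) : RegularFamily fun a w => ¬ p a w := by
  obtain ⟨hp, N, hN, h⟩ := hp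
  exact ⟨hp.not, N, hN, fun a => (h a).compl⟩

theorem and (hp : RegularFamily p) (hq : RegularFamily q) :
    RegularFamily fun a w => p a w ∧ q a w := by
  obtain ⟨hp, N, hN, h⟩ := hp
  obtain ⟨hq, M, hM, h'⟩ := hq
  exact ⟨hp.and hq, fun a => N a * M a, by fun_prop, fun a => (h a).inter (h' a)⟩

theorem preimage {p : α → List γ → Prop} (hp : RegularFamily p) {φ : List β → List γ}
    (hφ : Primrec φ) (hφ' : ∀ x y, φ (x ++ y) = φ x ++ φ y) :
    RegularFamily fun a w => p a (φ w) := by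
  obtain ⟨hp, N, hN, h⟩ := hp
  exact ⟨hp.comp (f := fun x : α × List β => (x.1, φ x.2)) (by fun_prop), N, hN,
    fun a => (h a).preimage hφ'⟩

open Classical in
theorem primrec_encard (hp : RegularFamily p) (hB : LettersBounded p) :
    Primrec fun a => {w | p a w}.encard := by
  obtain ⟨hp, N, hN, hquot⟩ := hp
  obtain ⟨B, hB, hpB⟩ := hB
  let short (a : α) : List (List β) := codesLE (List β) (codeBound (B a) (2 * N a))
  have hshort : Primrec short := by fun_prop
  have mem_short {a w} (hw : p a w) (hl : w.length ≤ 2 * N a) : w ∈ short a :=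
    mem_codesLE.2 (encode_le_codeBound hl (hpB a w hw))
  have hlong : PrimrecPred fun a => ∃ w ∈ short a, N a ≤ w.length ∧ p a w :=
    primrecPred_exists_mem hshort (by fun_prop)
  refine (Primrec.ite hlong (.const ⊤) (primrec_natCast.comp (Primrec.list_length.comp
    (primrec_filter hshort hp)))).of_eq fun a => ?_
  split_ifs with h
  · obtain ⟨w, -, hl, hw⟩ := h
    exact (Set.encard_eq_top ((hquot a).infinite hw hl)).symm
  · have hlt (w) (hw : p a w) : w.length < N a := by
      by_contra! hl
      obtain ⟨w', hw', hl', hlt⟩ := (hquot a).exists_length_lt hw hl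
      exact h ⟨w', mem_short hw' hlt.le, hl', hw'⟩
    have hfilter : {w | p a w} = ((short a).filter (p a ·)).toFinset := by
      ext w
      simp only [Set.mem_ofPred_eq, List.coe_toFinset, List.mem_filter, decide_eq_true_eq]
      exact ⟨fun hw => ⟨mem_short hw (by have := hlt w hw; omega), hw⟩, And.right⟩
    rw [hfilter, Set.encard_coe_eq_coe_finsetCard,
      List.toFinset_card_of_nodup ((nodup_codesLE _).filter _)]

theorem primrecPred_exists (hp : RegularFamily p) (hB : LettersBounded p) :
    PrimrecPred fun a => ∃ w, p a w :=
  (primrecPred_eq (hp.primrec_encard hB) (.const 0)).not.of_eq fun a => by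
    simp [Set.eq_empty_iff_forall_notMem]

theorem primrecPred_finite_and_exists (hp : RegularFamily p) (hB : LettersBounded p)
    (hq : PrimrecPred fun x : α × List β => q x.1 x.2) :
    PrimrecPred fun a => {w | p a w}.Finite ∧ ∃ w, p a w ∧ q a w := by
  have hfin : PrimrecPred fun a => {w | p a w}.Finite :=
    (primrecPred_eq (hp.primrec_encard hB) (.const ⊤)).not.of_eq fun a => by simp
  obtain ⟨hp, N, hN, hquot⟩ := hp
  obtain ⟨B, hB, hpB⟩ := hB
  have hsearch : PrimrecPred fun a =>
      ∃ w ∈ codesLE (List β) (codeBound (B a) (N a)), p a w ∧ q a w :=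
    primrecPred_exists_mem (by fun_prop) (by fun_prop)
  refine (hfin.and hsearch).of_eq fun a => and_congr_right fun h => ?_
  refine ⟨fun ⟨w, _, hw⟩ => ⟨w, hw⟩, fun ⟨w, hw⟩ => ⟨w, mem_codesLE.2 ?_, hw⟩⟩
  exact encode_le_codeBound ((hquot a).length_lt h hw.1).le (hpB a w hw.1)

end RegularFamily
end RegularFamily

/-! ### Finite automata -/

namespace FinAut

variable {α : Type} {A : FinAut α}

@[fun_prop]
theorem primrec_trans [Primcodable α] : Primrec (FinAut.trans (α := α)) :=
  Primrec.fst.comp (Primrec.of_equiv (e := FinAut.equivProd α))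

@[fun_prop]
theorem primrec_init [Primcodable α] : Primrec (FinAut.init (α := α)) :=
  Primrec.fst.comp (Primrec.snd.comp (Primrec.of_equiv (e := FinAut.equivProd α)))

@[fun_prop]
theorem primrec_final [Primcodable α] : Primrec (FinAut.final (α := α)) :=
  Primrec.snd.comp (Primrec.snd.comp (Primrec.of_equiv (e := FinAut.equivProd α)))

open Classical in
/-- The states reached from the states of the list `S` by the letter `a`. -/
noncomputable def next (A : FinAut α) (S : List ℕ) (a : α) : List ℕ :=
  (A.trans.filter fun t => t.1 ∈ S ∧ t.2.1 = a).map fun t => t.2.2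

theorem mem_next {S : List ℕ} {a : α} {q : ℕ} :
    q ∈ A.next S a ↔ ∃ p ∈ S, (p, a, q) ∈ A.trans := by
  simp only [next, List.mem_map, List.mem_filter, decide_eq_true_eq, Prod.exists]
  grind

theorem mem_foldl_next {w : List α} {q : ℕ} :
    q ∈ w.foldl A.next A.init ↔ q ∈ A.toNFA.eval w := by
  induction w using List.reverseRecOn generalizing q with
  | nil => rfl
  | append_singleton w a ih =>
    simp only [List.foldl_append, List.foldl_cons, List.foldl_nil, mem_next, ih,
      NFA.eval_append_singleton, NFA.mem_stepSet]
    rfl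

theorem primrecPred_mem_language [Primcodable α] :
    PrimrecPred fun x : FinAut α × List α => x.2 ∈ x.1.language := by
  classical
  have hnext : Primrec fun x : (FinAut α × List α) × List ℕ × α => x.1.1.next x.2.1 x.2.2 :=
    Primrec.list_map (primrec_filter (by fun_prop) (by fun_prop))
      (Primrec.snd.comp (Primrec.snd.comp .snd)).to₂
  have hfoldl : Primrec fun x : FinAut α × List α => x.2.foldl x.1.next x.1.init :=
    Primrec.list_foldl .snd (by fun_prop) hnext.to₂
  refine (primrecPred_exists_mem (p := fun x q => q ∈ x.2.foldl x.1.next x.1.init)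
    (l := fun x : FinAut α × List α => x.1.final) (by fun_prop)
    (primrecPred_mem (hfoldl.comp .fst) .snd)).of_eq fun x => ?_
  simp only [mem_foldl_next]
  rfl

theorem exists_mem_trans_of_mem_language {w : List α} (hw : w ∈ A.language) {a : α} (ha : a ∈ w) :
    ∃ t ∈ A.trans, t.2.1 = a := by
  obtain ⟨x, z, rfl⟩ := List.append_of_mem ha
  by_contra! hne
  have hstep (S : Set ℕ) : A.toNFA.stepSet S a = ∅ :=
    Set.eq_empty_of_forall_notMem fun q hq => by
      obtain ⟨p, -, hp⟩ := (NFA.mem_stepSet ..).1 hq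
      exact hne _ hp rfl
  obtain ⟨q, -, hq⟩ := hw
  rw [NFA.eval, NFA.evalFrom_append, NFA.evalFrom_cons, hstep,
    NFA.evalFrom_eq_biUnion_singleton] at hq
  simp at hq

theorem lettersBounded_language [Primcodable α] :
    LettersBounded fun (A : FinAut α) w => w ∈ A.language := by
  refine ⟨fun A => Encodable.encode (A.trans.map fun t => t.2.1), Primrec.encode.comp
    (Primrec.list_map (by fun_prop) (Primrec.fst.comp (Primrec.snd.comp .snd)).to₂),
    fun A w hw a ha => ?_⟩
  obtain ⟨t, ht, rfl⟩ := exists_mem_trans_of_mem_language hw ha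
  exact encode_le_of_mem (List.mem_map.2 ⟨t, ht, rfl⟩)

/-- A bound for the number of left quotients of the language of an automaton. -/
def stateBound (A : FinAut α) : ℕ :=
  2 ^ (A.init.length + A.trans.length)

@[fun_prop]
theorem primrec_stateBound [Primcodable α] : Primrec (stateBound (α := α)) :=
  primrec_pow.comp (g := fun A : FinAut α => (2, A.init.length + A.trans.length)) (by fun_prop)

theorem eval_subset (w : List α) :
    A.toNFA.eval w ⊆ {q | q ∈ A.init ++ A.trans.map fun t => t.2.2} := by
  intro q hq
  rcases List.eq_nil_or_concat w with rfl | ⟨w, a, rfl⟩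
  · exact List.mem_append_left _ hq
  · rw [List.concat_eq_append, NFA.eval_append_singleton, NFA.mem_stepSet] at hq
    obtain ⟨p, -, hp⟩ := hq
    exact List.mem_append_right _ (List.mem_map.2 ⟨_, hp, rfl⟩)

theorem fewQuotients_language (A : FinAut α) : FewQuotients A.language A.stateBound := by
  refine .of_coloring A.toNFA.eval ?_ fun x y hxy z => ?_
  · let states := A.init ++ A.trans.map fun t => t.2.2
    have hsub : Set.range A.toNFA.eval ⊆
        (fun T : Finset ℕ => (T : Set ℕ)) '' states.toFinset.powerset := by
      rintro _ ⟨w, rfl⟩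
      have hfin : (A.toNFA.eval w).Finite := (List.finite_toSet states).subset (eval_subset w)
      exact ⟨hfin.toFinset, Finset.mem_powerset.2 fun q hq =>
        List.mem_toFinset.2 (eval_subset w (hfin.mem_toFinset.1 hq)), hfin.coe_toFinset⟩
    refine (Set.encard_le_encard hsub).trans ((Set.encard_image_le _ _).trans ?_)
    rw [Set.encard_coe_eq_coe_finsetCard, Finset.card_powerset, Nat.cast_le]
    refine Nat.pow_le_pow_right two_pos ((List.toFinset_card_le states).trans ?_)
    simp [states]
  · rintro ⟨q, hq, hqx⟩
    refine ⟨q, hq, ?_⟩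
    rw [NFA.eval, NFA.evalFrom_append] at hqx ⊢
    exact (hxy ▸ hqx : q ∈ A.toNFA.evalFrom (A.toNFA.eval y) z)

theorem regularFamily_language [Primcodable α] :
    RegularFamily fun (A : FinAut α) w => w ∈ A.language :=
  ⟨primrecPred_mem_language, stateBound, by fun_prop, fewQuotients_language⟩

end FinAut

/-! ### Fibres of projections -/

theorem encard_eq_sum_encard_fiberwise {α σ : Type} [Fintype σ] (S : Set α) (f : α → σ) :
    S.encard = ∑ i, {x ∈ S | f x = i}.encard := by
  classical
  have h (I : Finset σ) : {x ∈ S | f x ∈ I}.encard = ∑ i ∈ I, {x ∈ S | f x = i}.encard := by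
    induction I using Finset.induction_on with
    | empty => simp
    | insert i I hi ih =>
      rw [Finset.sum_insert hi, ← ih, ← Set.encard_union_eq]
      · congr 1
        ext x
        simp only [Finset.mem_insert, Set.mem_ofPred_eq, Set.mem_union]
        tauto
      · exact Set.disjoint_left.2 fun x hx hx' => hi (hx.2 ▸ hx'.2)
  simpa using h Finset.univ

theorem natCast_le_sum_mul_of_min_eq {σ : Type} [Fintype σ] {k : ℕ} {a a' b : σ → ℕ∞}
    (h : ∀ i, min (k : ℕ∞) (a i) = min (k : ℕ∞) (a' i)) (hk : k ≤ ∑ i, a i * b i) :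
    k ≤ ∑ i, a' i * b i := by
  by_cases hbig : ∃ i, k ≤ a' i ∧ b i ≠ 0
  · obtain ⟨i, hi, hb⟩ := hbig
    calc (k : ℕ∞) ≤ a' i * b i := hi.trans (le_mul_of_one_le_right' (Order.one_le_iff_pos.2
            (pos_iff_ne_zero.2 hb)))
      _ ≤ ∑ i, a' i * b i := Finset.single_le_sum (f := fun i => a' i * b i)
            (fun _ _ => zero_le) (Finset.mem_univ i)
  · push Not at hbig
    refine hk.trans (Finset.sum_le_sum fun i _ => ?_)
    by_cases hi : k ≤ a' i
    · simp [hbig i hi]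
    · have hmin := (h i).trans (min_eq_right (not_le.1 hi).le)
      have ha : a i = a' i := by
        rcases le_total (k : ℕ∞) (a i) with hka | hka
        · exact absurd (min_eq_left hka ▸ hmin).le hi
        · rwa [min_eq_right hka] at hmin
      rw [ha]

section Fiber

variable {γ β : Type} {L : Set (List β)} {π : β → Option γ} {m N : ℕ}

/-- The words of `L` whose image under the projection `π` is the word `y`, padded by at least `m`
symbols `none`. -/
def fiber (L : Set (List β)) (π : β → Option γ) (m : ℕ) (y : List γ) : Set (List β) :=
  {w ∈ L | ∃ j, m ≤ j ∧ w.map π = y.map some ++ List.replicate j none}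

theorem append_mem_fiber {x y : List γ} {v w : List β} (h : v.length = x.length) :
    v ++ w ∈ fiber L π m (x ++ y) ↔
      v.map π = x.map some ∧ w ∈ fiber (Language.leftQuotient L v) π m y := by
  have hmap (j : ℕ) : (v ++ w).map π = (x ++ y).map some ++ List.replicate j none ↔
      v.map π = x.map some ∧ w.map π = y.map some ++ List.replicate j none := by
    rw [List.map_append, List.map_append, List.append_assoc]
    exact ⟨fun h' => List.append_inj h' (by simp [h]), fun h' => by rw [h'.1, h'.2]⟩
  simp only [fiber, Set.mem_ofPred_eq, hmap]
  exact ⟨fun ⟨hL, j, hj, hv, hw⟩ => ⟨hv, hL, j, hj, hw⟩,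
    fun ⟨hv, hL, j, hj, hw⟩ => ⟨hL, j, hj, hv, hw⟩⟩

theorem encard_fiber_append [Fintype (Set.range (Language.leftQuotient L))] (x z : List γ) :
    (fiber L π m (x ++ z)).encard = ∑ Q : Set.range (Language.leftQuotient L),
      {v | v.map π = x.map some ∧ Language.leftQuotient L v = Q}.encard *
        (fiber Q.1 π m z).encard := by
  rw [encard_eq_sum_encard_fiberwise _ fun w => Set.rangeFactorization (Language.leftQuotient L)
    (w.take x.length)]
  refine Finset.sum_congr rfl fun Q _ => ?_
  have hlen {v : List β} (hv : v.map π = x.map some) : v.length = x.length := by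
    simpa using congrArg List.length hv
  rw [← Set.encard_prod, ← Set.InjOn.encard_image (f := fun v : List β × List β => v.1 ++ v.2)]
  · congr 1
    ext w
    constructor
    · rintro ⟨hw, rfl⟩
      have htake : (w.take x.length).length = x.length := by
        obtain ⟨-, j, -, hj⟩ := hw
        simpa using (by simpa using congrArg List.length hj : w.length = _).ge.trans' (by omega)
      rw [← List.take_append_drop x.length w, append_mem_fiber htake] at hw
      exact ⟨(w.take x.length, w.drop x.length), ⟨⟨hw.1, rfl⟩, hw.2⟩, List.take_append_drop _ _⟩
    · rintro ⟨⟨v, w⟩, ⟨⟨hv, hQ⟩, hw⟩, rfl⟩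
      exact ⟨(append_mem_fiber (hlen hv)).2 ⟨hv, hQ ▸ hw⟩,
        Subtype.ext (by simp [← hlen hv, hQ])⟩
  · rintro ⟨v, w⟩ ⟨⟨hv, -⟩, -⟩ ⟨v', w'⟩ ⟨⟨hv', -⟩, -⟩ h
    obtain ⟨rfl, rfl⟩ := List.append_inj h ((hlen hv).trans (hlen hv').symm)
    rfl

namespace FewQuotients

theorem le_encard_fiber (h : FewQuotients L N) (k : ℕ) :
    FewQuotients {y | k ≤ (fiber L π m y).encard} ((k + 1) ^ N) := by
  classical
  have : Fintype (Set.range (Language.leftQuotient L)) := (Set.finite_of_encard_le_coe h).fintype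
  refine of_coloring (fun (x : List γ) (Q : Set.range (Language.leftQuotient L)) =>
    min (k : ℕ∞) {v | v.map π = x.map some ∧ Language.leftQuotient L v = Q}.encard) ?_
    fun x y hxy z hz => ?_
  · have hIic : (Set.Iic (k : ℕ∞)).encard = (k + 1 : ℕ) := by
      rw [← Nat.card_Iic, ← Set.encard_coe_eq_coe_finsetCard, Finset.coe_Iic]
      exact (congrArg Set.encard WithTop.image_coe_Iic.symm).trans
        (WithTop.coe_injective.encard_image _)
    refine (Set.encard_le_encard (t := Set.univ.pi fun _ => Set.Iic (k : ℕ∞)) ?_).trans ?_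
    · rintro _ ⟨x, rfl⟩ Q -
      exact min_le_left (k : ℕ∞) _
    · rw [Set.encard_pi_eq_prod_encard, Finset.prod_const, hIic, ← Nat.cast_pow, Nat.cast_le,
        Finset.card_univ]
      refine Nat.pow_le_pow_right k.succ_pos ?_
      rwa [← Nat.cast_le (α := ℕ∞), Set.coe_fintypeCard]
  · rw [Set.mem_ofPred_eq, encard_fiber_append] at hz ⊢
    exact natCast_le_sum_mul_of_min_eq (congrFun hxy) hz

theorem cons (h : FewQuotients L N) (b : β) : FewQuotients (List.cons b '' L) (N + 2) := by
  have hsub : Set.range (Language.leftQuotient (List.cons b '' L)) ⊆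
      insert (List.cons b '' L) (insert (∅ : Set _) (Set.range (Language.leftQuotient L))) := by
    rintro _ ⟨_ | ⟨c, x⟩, rfl⟩
    · exact Or.inl rfl
    · by_cases hc : b = c
      · refine Or.inr (Or.inr ⟨x, ?_⟩)
        subst hc
        ext z
        exact (List.cons_injective.mem_set_image (s := L) (a := x ++ z)).symm
      · refine Or.inr (Or.inl (Set.eq_empty_of_forall_notMem ?_))
        rintro z ⟨w, -, hw⟩
        exact hc (List.cons.inj hw).1
  refine (Set.encard_le_encard hsub).trans ?_
  calc _ ≤ (Set.range (Language.leftQuotient L)).encard + 1 + 1 :=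
        (Set.encard_insert_le _ _).trans (by gcongr; exact Set.encard_insert_le _ _)
    _ ≤ (N + 2 : ℕ) := by rw [add_assoc]; push_cast; gcongr; exacts [h, le_rfl]

theorem forall_mem (p : β → Prop) : FewQuotients {w | ∀ b ∈ w, p b} 2 := by
  refine of_coloring (fun w => ∀ b ∈ w, p b) ?_ fun x y hxy z hz => ?_
  · refine (Set.encard_le_encard (Set.subset_univ _)).trans ?_
    simp [ENat.card_eq_coe_fintype_card]
  · simp only [Set.mem_ofPred_eq, List.forall_mem_append] at hz ⊢
    exact ⟨hxy.mp hz.1, hz.2⟩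

theorem padded (y : List γ) : FewQuotients
    {w : List (Option γ) | ∃ j, w = y.map some ++ List.replicate j none} (2 * (y.length + 1)) := by
  induction y with
  | nil =>
    simpa [List.eq_replicate_iff] using forall_mem (fun b : Option γ => b = none)
  | cons a y ih =>
    refine cast (congrArg (FewQuotients · _) ?_) (ih.cons (some a))
    ext w
    simp [Set.mem_image]
    grind

theorem fiber_zero (h : FewQuotients L N) (y : List γ) :
    FewQuotients (fiber L π 0 y) (N * (2 * (y.length + 1))) := by
  have hpad := (padded y).preimage (φ := List.map π) fun _ _ => List.map_append
  refine cast (congrArg (FewQuotients · _) ?_) (h.inter hpad)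
  ext w
  simp [fiber]

end FewQuotients

theorem encard_fiber_eq_top_iff [Encodable β] {B : ℕ} (h : FewQuotients L N)
    (hB : ∀ w ∈ L, ∀ b ∈ w, Encodable.encode b ≤ B) (y : List γ) :
    (fiber L π 0 y).encard = ⊤ ↔ (1 : ℕ) ≤ (fiber L π (N * 2) y).encard := by
  rw [Nat.cast_one, Set.one_le_encard_iff_nonempty, Set.encard_eq_top_iff]
  constructor
  · intro hinf
    by_contra hne
    refine hinf (finite_of_bounded (B := B) (n := y.length + N * 2) (fun w hw => hB w hw.1) ?_)
    rintro w ⟨hw, j, -, hj⟩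
    by_contra hl
    refine hne ⟨w, hw, j, ?_, hj⟩
    have hlen : w.length = y.length + j := by simpa using congrArg List.length hj
    omega
  · rintro ⟨w, hw, j, hj, hwj⟩
    have hlen : w.length = y.length + j := by simpa using congrArg List.length hwj
    obtain ⟨v, z, rfl, hv⟩ : ∃ v z, w = v ++ z ∧ v.length = y.length :=
      ⟨_, _, (List.take_append_drop y.length w).symm, by simp [hlen]⟩
    have hzj : z.length = j := by simpa [hv] using hlen
    have hmem := (append_mem_fiber (L := L) (π := π) (m := 0) (y := []) (w := z) hv).1
      ⟨hw, j, j.zero_le, by simpa using hwj⟩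
    have hinf := ((h.leftQuotient v).fiber_zero []).infinite hmem.2 (by simpa [hzj] using hj)
    refine (hinf.image (List.append_right_injective v).injOn).mono ?_
    rintro _ ⟨z', hz', rfl⟩
    simpa using (append_mem_fiber (y := []) hv).2 ⟨hmem.1, hz'⟩

section RegularFamily

variable {α : Type} [Primcodable α] [Primcodable β] [Primcodable γ] {p : α → List β → Prop}

theorem primrecPred_mem_fiber (hp : PrimrecPred fun x : α × List β => p x.1 x.2)
    (hπ : Primrec π) :
    PrimrecPred fun x : (α × List γ) × List β => x.2 ∈ fiber {w | p x.1.1 w} π 0 x.1.2 := by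
  have hpad : PrimrecPred fun x : ((α × List γ) × List β) × ℕ =>
      x.1.2.map π = x.1.1.2.map some ++ (List.range x.2).map fun _ => none :=
    primrecPred_eq (Primrec.list_map (by fun_prop) (hπ.comp .snd).to₂)
      (Primrec.list_append.comp (Primrec.list_map (by fun_prop) (Primrec.option_some.comp .snd).to₂)
        (Primrec.list_map (by fun_prop) (Primrec.const none).to₂))
  refine ((hp.comp (f := fun x : (α × List γ) × List β => (x.1.1, x.2)) (by fun_prop)).and
    (primrecPred_exists_mem (l := fun x : (α × List γ) × List β => List.range (x.2.length + 1))
      (p := fun x j => x.2.map π = x.1.2.map some ++ (List.range j).map fun _ => none)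
      (by fun_prop) hpad)).of_eq fun x => and_congr_right fun _ => ?_
  simp only [List.mem_range, List.map_const', List.length_range, Nat.zero_le, true_and]
  refine exists_congr fun j => and_iff_right_of_imp fun h => ?_
  have hlen : x.2.length = x.1.2.length + j := by simpa using congrArg List.length h
  omega

theorem RegularFamily.mem_fiber (hp : RegularFamily p) (hπ : Primrec π) :
    RegularFamily fun (x : α × List γ) w => w ∈ fiber {w | p x.1 w} π 0 x.2 := by
  obtain ⟨hp, N, hN, h⟩ := hp
  exact ⟨primrecPred_mem_fiber hp hπ, fun x => N x.1 * (2 * (x.2.length + 1)), by fun_prop,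
    fun x => (h x.1).fiber_zero x.2⟩

theorem RegularFamily.primrec_encard_fiber (hp : RegularFamily p) (hB : LettersBounded p)
    (hπ : Primrec π) : Primrec fun x : α × List γ => (fiber {w | p x.1 w} π 0 x.2).encard :=
  (hp.mem_fiber hπ).primrec_encard ((hB.comp .fst).mono fun _ _ hw => hw.1)

theorem RegularFamily.encard_fiber_eq (hp : RegularFamily p) (hB : LettersBounded p)
    (hπ : Primrec π) :
    RegularFamily fun (x : α × ℕ∞) (y : List γ) => (fiber {w | p x.1 w} π 0 y).encard = x.2 := by
  have hcard : Primrec fun x : (α × ℕ∞) × List γ => (fiber {w | p x.1.1 w} π 0 x.2).encard :=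
    (hp.primrec_encard_fiber hB hπ).comp (g := fun x : (α × ℕ∞) × List γ => (x.1.1, x.2))
      (by fun_prop)
  refine ⟨primrecPred_eq hcard (by fun_prop), ?_⟩
  obtain ⟨-, N, hN, h⟩ := hp
  obtain ⟨B, -, hpB⟩ := hB
  refine ⟨fun x => (x.2.toNat + 2) ^ N x.1 * (x.2.toNat + 2) ^ N x.1, by fun_prop, fun x => ?_⟩
  obtain ⟨a, κ⟩ := x
  induction κ using ENat.recTopCoe with
  | top =>
    simp only [encard_fiber_eq_top_iff (h a) (hpB a)]
    exact ((h a).le_encard_fiber 1).mono (by simpa using Nat.le_mul_self (2 ^ N a))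
  | coe k =>
    have hset : {y | (fiber {w | p a w} π 0 y).encard = k} =
        {y | k ≤ (fiber {w | p a w} π 0 y).encard} ∩
          {y | (k + 1 : ℕ) ≤ (fiber {w | p a w} π 0 y).encard}ᶜ := by
      ext y
      simp only [Set.mem_inter_iff, Set.mem_ofPred_eq, Set.mem_compl_iff]
      rw [Nat.cast_add, Nat.cast_one, ENat.add_one_le_iff (ENat.natCast_ne_top k), not_lt,
        eq_comm, le_antisymm_iff]
    rw [hset]
    refine (((h a).le_encard_fiber k).inter ((h a).le_encard_fiber (k + 1)).compl).mono ?_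
    exact Nat.mul_le_mul (Nat.pow_le_pow_left (by simp) _) (Nat.pow_le_pow_left (by simp) _)

end RegularFamily

end Fiber

/-! ### Convolutions -/

section Conv

variable {u v x y z : List ℕ} {w : List (Option ℕ × Option ℕ)} {N : ℕ}

@[simp]
theorem length_conv (u v : List ℕ) : (conv u v).length = max u.length v.length := by
  simp [conv]

theorem map_swap_conv (u v : List ℕ) : (conv u v).map Prod.swap = conv v u := by
  simp [conv, max_comm]

theorem map_fst_conv (u v : List ℕ) : (conv u v).map Prod.fst =
    u.map some ++ List.replicate ((conv u v).length - u.length) none := by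
  refine List.ext_getElem (by simp) fun i h _ => ?_
  rcases lt_or_ge i u.length with hi | hi
  · simp [conv, List.getElem_append_left, hi]
  · simp [conv, List.getElem_append_right, hi]

theorem map_snd_conv (u v : List ℕ) : (conv u v).map Prod.snd =
    v.map some ++ List.replicate ((conv u v).length - v.length) none := by
  have h := map_fst_conv v u
  rwa [← map_swap_conv, List.map_map, List.length_map] at h

theorem filterMap_eq_of_map_eq {β γ : Type} {π : β → Option γ} {w : List β} {y : List γ} {j : ℕ}
    (h : w.map π = y.map some ++ List.replicate j none) : w.filterMap π = y := by
  rw [← Function.id_comp π, ← List.filterMap_map, h]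
  simp [List.filterMap_append, List.filterMap_map]

theorem filterMap_fst_conv (u v : List ℕ) : (conv u v).filterMap Prod.fst = u :=
  filterMap_eq_of_map_eq (map_fst_conv u v)

theorem filterMap_snd_conv (u v : List ℕ) : (conv u v).filterMap Prod.snd = v := by
  have h := filterMap_fst_conv v u
  rwa [← map_swap_conv, List.filterMap_map] at h

theorem conv_left_injective (v : List ℕ) : Function.Injective (conv · v) :=
  Function.LeftInverse.injective fun u => filterMap_fst_conv u v

theorem conv_right_injective (u : List ℕ) : Function.Injective (conv u) :=
  Function.LeftInverse.injective (filterMap_snd_conv u)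

/-- The words that are convolutions of two words. -/
def convs : Set (List (Option ℕ × Option ℕ)) :=
  {w | conv (w.filterMap Prod.fst) (w.filterMap Prod.snd) = w}

theorem conv_mem_convs (u v : List ℕ) : conv u v ∈ convs := by
  simp only [convs, Set.mem_ofPred_eq, filterMap_fst_conv, filterMap_snd_conv]

theorem fiber_convs_fst (L : Set (List (Option ℕ × Option ℕ))) (u : List ℕ) :
    fiber (L ∩ convs) Prod.fst 0 u = conv u '' {v | conv u v ∈ L} := by
  ext w
  constructor
  · rintro ⟨⟨hw, hconv⟩, j, -, hj⟩
    obtain rfl := filterMap_eq_of_map_eq hj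
    exact ⟨w.filterMap Prod.snd, hconv.symm.subst (motive := (· ∈ L)) hw, hconv⟩
  · rintro ⟨v, hv, rfl⟩
    exact ⟨⟨hv, conv_mem_convs u v⟩, _, Nat.zero_le _, map_fst_conv u v⟩

theorem fiber_convs_snd (L : Set (List (Option ℕ × Option ℕ))) (v : List ℕ) :
    fiber (L ∩ convs) Prod.snd 0 v = (conv · v) '' {u | conv u v ∈ L} := by
  ext w
  constructor
  · rintro ⟨⟨hw, hconv⟩, j, -, hj⟩
    obtain rfl := filterMap_eq_of_map_eq hj
    exact ⟨w.filterMap Prod.fst, hconv.symm.subst (motive := (· ∈ L)) hw, hconv⟩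
  · rintro ⟨u, hu, rfl⟩
    exact ⟨⟨hu, conv_mem_convs u v⟩, _, Nat.zero_le _, map_snd_conv u v⟩

theorem conv_append (u x z : List ℕ) :
    conv u (x ++ z) = conv (u.take x.length) x ++ conv (u.drop x.length) z := by
  refine List.ext_getElem (by simp; omega) fun i h _ => ?_
  rcases lt_or_ge i x.length with hi | hi
  · rw [List.getElem_append_left (by simp [hi])]
    simp [conv, hi, List.getElem?_append_left]
  · rw [List.getElem_append_right (by simp [hi])]
    simp [conv, hi, List.getElem?_append_right]

theorem mem_conv_of_mem_right {a : ℕ} (h : a ∈ v) : ∃ o, (o, some a) ∈ conv u v := by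
  obtain ⟨b, hb, hab⟩ := List.mem_map.1 ((map_snd_conv u v).symm ▸
    List.mem_append_left _ (List.mem_map_of_mem (f := some) h))
  exact ⟨b.1, hab ▸ hb⟩

@[fun_prop]
theorem primrec_conv : Primrec fun x : List ℕ × List ℕ => conv x.1 x.2 :=
  Primrec.list_map
    (Primrec.list_range.comp (Primrec.nat_max.comp (by fun_prop) (by fun_prop)))
    ((Primrec.list_getElem?.comp (Primrec.fst.comp .fst) .snd).pair
      (Primrec.list_getElem?.comp (Primrec.snd.comp .fst) .snd)).to₂

theorem FewQuotients.conv_left {L : Set (List (Option ℕ × Option ℕ))} (h : FewQuotients L N)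
    (u : List ℕ) : FewQuotients {y | conv u y ∈ L} ((u.length + 1) * N) := by
  refine .of_coloring (fun y => (min y.length u.length,
    Language.leftQuotient L (conv (u.take y.length) y))) ?_ fun x y hxy z hz => ?_
  · refine (Set.encard_le_encard (t := Set.Iic u.length ×ˢ Set.range (Language.leftQuotient L))
      ?_).trans ?_
    · rintro _ ⟨y, rfl⟩
      exact ⟨Nat.min_le_right y.length u.length, Set.mem_range_self _⟩
    · rw [Set.encard_prod, ← Finset.coe_Iic, Set.encard_coe_eq_coe_finsetCard, Nat.card_Iic,
        Nat.cast_mul]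
      exact mul_le_mul_right h _
  · rw [Prod.mk.injEq] at hxy
    have hdrop : u.drop x.length = u.drop y.length := by
      rw [List.drop_eq_drop_min, hxy.1, ← List.drop_eq_drop_min]
    rw [Set.mem_ofPred_eq, conv_append] at hz ⊢
    exact hdrop ▸ hxy.2.le hz

theorem pairwise_padded {γ : Type} (y : List γ) (j : ℕ) :
    (y.map some ++ List.replicate j none).Pairwise fun a b => a = none → b = none := by
  simp [List.pairwise_append, List.pairwise_map, List.pairwise_replicate, List.pairwise_of_forall]

theorem getElem?_filterMap_of_pairwise {β γ : Type} {π : β → Option γ} {w : List β}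
    (h : (w.map π).Pairwise fun a b => a = none → b = none) (i : ℕ) :
    (w.filterMap π)[i]? = w[i]?.bind π := by
  induction w generalizing i with
  | nil => simp
  | cons b w ih =>
    rw [List.map_cons, List.pairwise_cons] at h
    cases hb : π b with
    | some a => cases i <;> simp [hb, ih h.2]
    | none =>
      have hnone : ∀ c ∈ w, π c = none := fun c hc => h.1 _ (List.mem_map_of_mem hc) hb
      rw [List.filterMap_cons_none hb, List.filterMap_eq_nil_iff.2 hnone, List.getElem?_nil,
        eq_comm, Option.bind_eq_none_iff]
      rintro c hc
      rcases List.mem_cons.1 (List.mem_of_getElem? hc) with rfl | hc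
      exacts [hb, hnone c hc]

theorem mem_convs_iff : w ∈ convs ↔ ((w.map Prod.fst).Pairwise fun a b => a = none → b = none) ∧
    ((w.map Prod.snd).Pairwise fun a b => a = none → b = none) ∧ ∀ b ∈ w, b ≠ (none, none) := by
  constructor
  · rw [convs, Set.mem_ofPred_eq]
    generalize w.filterMap Prod.fst = u, w.filterMap Prod.snd = v
    rintro rfl
    rw [map_fst_conv, map_snd_conv]
    refine ⟨pairwise_padded _ _, pairwise_padded _ _, fun b hb => ?_⟩
    obtain ⟨i, hi, rfl⟩ := List.mem_map.1 hb
    rw [List.mem_range, lt_max_iff] at hi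
    simpa [imp_iff_not_or, not_le] using hi
  · rintro ⟨hfst, hsnd, hne⟩
    have hfst' := getElem?_filterMap_of_pairwise hfst
    have hsnd' := getElem?_filterMap_of_pairwise hsnd
    have hlen : max (w.filterMap Prod.fst).length (w.filterMap Prod.snd).length = w.length := by
      refine le_antisymm (max_le (List.length_filterMap_le ..) (List.length_filterMap_le ..)) ?_
      by_contra! hlt
      have h1 := List.getElem?_eq_none (l := w.filterMap Prod.fst)
        (le_max_left _ (w.filterMap Prod.snd).length)
      have h2 := List.getElem?_eq_none (l := w.filterMap Prod.snd)
        (le_max_right (w.filterMap Prod.fst).length _)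
      rw [hfst', List.getElem?_eq_getElem hlt, Option.bind_some] at h1
      rw [hsnd', List.getElem?_eq_getElem hlt, Option.bind_some] at h2
      exact hne _ (List.getElem_mem hlt) (Prod.ext h1 h2)
    refine List.ext_getElem (by simp [hlen]) fun i _ hi => ?_
    simp [conv, hfst', hsnd', hi]

theorem fewQuotients_pairwise (γ : Type) :
    FewQuotients {w : List (Option γ) | w.Pairwise fun a b => a = none → b = none} 4 := by
  refine .of_coloring (fun w => (w.Pairwise fun a b => a = none → b = none, none ∈ w)) ?_
    fun x y hxy z hz => ?_
  · refine (Set.encard_le_encard (Set.subset_univ _)).trans ?_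
    simp [ENat.card_eq_coe_fintype_card]
  · rw [Prod.mk.injEq] at hxy
    simp only [Set.mem_ofPred_eq, List.pairwise_append] at hz ⊢
    refine ⟨hxy.1.mp hz.1, hz.2.1, ?_⟩
    rintro _ ha b hb rfl
    exact hz.2.2 _ (hxy.2.mpr ha) b hb rfl

theorem fewQuotients_convs : FewQuotients convs (4 * (4 * 2)) := by
  have h := ((fewQuotients_pairwise ℕ).preimage (φ := List.map Prod.fst) fun _ _ =>
    List.map_append).inter (((fewQuotients_pairwise ℕ).preimage (φ := List.map Prod.snd) fun _ _ =>
    List.map_append).inter (.forall_mem fun b : Option ℕ × Option ℕ => b ≠ (none, none)))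
  exact cast (congrArg (FewQuotients · _) (Set.ext fun w => mem_convs_iff.symm)) h

end Conv

/-! ### Isomorphism invariants of trees -/

section Invariants

variable {V W : Type} {r : V → V → Prop} {s : W → W → Prop}

/-- The number of ancestors of a node; in a tree, this is its level plus one. -/
noncomputable def nUp (r : V → V → Prop) (y : V) : ℕ∞ := {x | r x y}.encard

/-- The number of descendants of a node, which is itself one of them in a tree. -/
noncomputable def nDown (r : V → V → Prop) (x : V) : ℕ∞ := {y | r x y}.encard

/-- In a tree, `y` is a child of `u`: a descendant on the next level. -/
def IsChild (r : V → V → Prop) (u y : V) : Prop := r u y ∧ nUp r y = nUp r u + 1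

/-- The values of the isomorphism invariants of subtrees of height at most `k + 1`. -/
def Inv : ℕ → Type
  | 0 => ℕ∞
  | k + 1 => Inv k → ℕ∞

/-- The invariant classifying the subtrees of height at most `k + 1`: the number of nodes for
`k = 0`, and the numbers of children of the root with each given invariant for larger `k`. -/
noncomputable def inv (r : V → V → Prop) : (k : ℕ) → V → Inv k
  | 0, u => nDown r u
  | k + 1, u => fun t => {y | IsChild r u y ∧ inv r k y = t}.encard

theorem encard_setOf_map {f : V → W} (hf : Function.Injective f) {p : V → Prop} {q : W → Prop}
    (h : ∀ x, q (f x) ↔ p x) (hq : ∀ y, q y → y ∈ Set.range f) :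
    {y | q y}.encard = {x | p x}.encard := by
  rw [← hf.encard_image]
  congr 1
  ext y
  constructor
  · intro hy
    obtain ⟨x, rfl⟩ := hq y hy
    exact ⟨x, (h x).1 hy, rfl⟩
  · rintro ⟨x, hx, rfl⟩
    exact (h x).2 hx

theorem encard_setOf_subtype {p : V → Prop} {q : V → Prop} :
    {c : {c // p c} | q c}.encard = {c | p c ∧ q c}.encard := by
  rw [← Subtype.val_injective.encard_image]
  congr 1
  ext c
  simp [and_comm]

theorem nUp_map (f : r ↪r s) (hs : ∀ x y, s x y → x ∈ Set.range f) (y : V) :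
    nUp s (f y) = nUp r y :=
  encard_setOf_map f.injective (fun _ => f.map_rel_iff) fun x => hs x (f y)

theorem nDown_map (f : r ↪r s) (hs : ∀ x y, s x y → y ∈ Set.range f) (x : V) :
    nDown s (f x) = nDown r x :=
  encard_setOf_map f.injective (fun _ => f.map_rel_iff) (hs (f x))

theorem inv_map (f : r ↪r s) (hs : ∀ x y, s x y → x ∈ Set.range f ∧ y ∈ Set.range f) (k : ℕ)
    (x : V) : inv s k (f x) = inv r k x := by
  induction k generalizing x with
  | zero => exact nDown_map f (fun x y h => (hs x y h).2) x
  | succ k ih =>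
    refine funext fun t => encard_setOf_map f.injective (fun y => ?_) fun y hy => (hs _ _ hy.1.1).2
    have hup := nUp_map f fun x y h => (hs x y h).1
    rw [IsChild, IsChild, f.map_rel_iff, hup, hup, ih]

theorem nonempty_equiv_of_encard_eq [Countable V] [Countable W] {A : Set V} {B : Set W}
    (h : A.encard = B.encard) : Nonempty (A ≃ B) :=
  Cardinal.eq.1 (Cardinal.toENat_injOn Cardinal.mk_le_aleph0 Cardinal.mk_le_aleph0 h)

theorem exists_equiv_preserving {T : Type} [Countable V] [Countable W] {f : V → T} {g : W → T}
    (h : ∀ t, {a | f a = t}.encard = {b | g b = t}.encard) : ∃ e : V ≃ W, ∀ a, g (e a) = f a := by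
  have hφ (t) : Nonempty ({a // f a = t} ≃ {b // g b = t}) := nonempty_equiv_of_encard_eq (h t)
  exact ⟨(Equiv.sigmaFiberEquiv f).symm.trans ((Equiv.sigmaCongrRight fun t => (hφ t).some).trans
    (Equiv.sigmaFiberEquiv g)), fun a => ((hφ (f a)).some ⟨a, rfl⟩).2⟩

end Invariants

section AddRoot

variable {ι κ : Type} {X : ι → Type} {Y : κ → Type} {q : ∀ i, X i → X i → Prop}
  {q' : ∀ i, Y i → Y i → Prop}

/-- The disjoint union of the relations `q i`, with a new least element `none`. -/
inductive AddRoot (q : ∀ i, X i → X i → Prop) : Option (Σ i, X i) → Option (Σ i, X i) → Prop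
  | root (x : Option (Σ i, X i)) : AddRoot q none x
  | branch {i : ι} {x y : X i} (h : q i x y) : AddRoot q (some ⟨i, x⟩) (some ⟨i, y⟩)

theorem addRoot_branch_iff {i : ι} {x y : X i} :
    AddRoot q (some ⟨i, x⟩) (some ⟨i, y⟩) ↔ q i x y :=
  ⟨fun h => by cases h; assumption, .branch⟩

theorem AddRoot.fst_eq {x y : Σ i, X i} (h : AddRoot q (some x) (some y)) : x.1 = y.1 := by
  cases h
  rfl

/-- Isomorphic families of relations remain isomorphic when least elements are added. -/
def AddRoot.congr (e : ι ≃ κ) (φ : ∀ i, q i ≃r q' (e i)) : AddRoot q ≃r AddRoot q' where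
  toEquiv := Equiv.optionCongr (Equiv.sigmaCongr e fun i => (φ i).toEquiv)
  map_rel_iff' {x y} := by
    rcases x with _ | ⟨i, x⟩
    · exact iff_of_true (.root _) (.root _)
    rcases y with _ | ⟨j, y⟩
    · exact iff_of_false nofun nofun
    by_cases hij : i = j
    · subst hij
      exact addRoot_branch_iff.trans ((φ i).map_rel_iff.trans addRoot_branch_iff.symm)
    · refine iff_of_false (fun h => hij (e.injective ?_)) fun h => hij (by cases h; rfl)
      exact AddRoot.fst_eq h

end AddRoot

namespace IsTree

variable {V W : Type} {r : V → V → Prop} {s : W → W → Prop} {u c c' x y : V}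

theorem nUp_ne_top (hr : IsTree r) (x : V) : nUp r x ≠ ⊤ :=
  Set.encard_ne_top_iff.2 (hr.finite x)

theorem nUp_lt (hr : IsTree r) (h : r x y) (hne : x ≠ y) : nUp r x < nUp r y :=
  (hr.finite x).encard_lt_encard ⟨fun _ hz => hr.trans _ _ _ hz h,
    fun hsub => hne (hr.antisymm _ _ h (hsub (hr.refl y)))⟩

theorem nUp_lt_of_isChild (hr : IsTree r) (h : IsChild r u c) : nUp r u < nUp r c :=
  h.2 ▸ (ENat.lt_add_one_iff (hr.nUp_ne_top u)).2 le_rfl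

theorem isChild_unique (hr : IsTree r) (hc : IsChild r u c) (hc' : IsChild r u c')
    (h : r c y) (h' : r c' y) : c = c' := by
  by_contra hne
  rcases hr.linear _ _ _ h h' with hcc | hcc
  · exact (hr.nUp_lt hcc hne).ne (hc.2.trans hc'.2.symm)
  · exact (hr.nUp_lt hcc (Ne.symm hne)).ne (hc'.2.trans hc.2.symm)

theorem exists_isChild (hr : IsTree r) (h : r u y) (hne : u ≠ y) : ∃ c, IsChild r u c ∧ r c y := by
  obtain ⟨c, ⟨hcy, huc, hne⟩, hmin⟩ := Set.exists_min_image {x | r x y ∧ r u x ∧ u ≠ x} (nUp r)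
    ((hr.finite y).subset fun x hx => hx.1) ⟨y, hr.refl y, h, hne⟩
  have hset : {x | r x c} = insert c {x | r x u} := by
    ext x
    refine ⟨fun hx => or_iff_not_imp_left.2 fun hxc => ?_, ?_⟩
    · by_contra hxu
      have hux : r u x := (hr.linear _ _ _ hx huc).resolve_left hxu
      exact (hr.nUp_lt hx hxc).not_ge (hmin x ⟨hr.trans _ _ _ hx hcy, hux,
        fun h => hxu (h ▸ hr.refl u)⟩)
    · rintro (rfl | hx)
      exacts [hr.refl x, hr.trans _ _ _ hx huc]
  refine ⟨c, ⟨huc, ?_⟩, hcy⟩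
  exact (congrArg Set.encard hset).trans (Set.encard_insert_of_notMem fun hcu =>
    hne (hr.antisymm _ _ huc hcu))

/-- A subtree consists of its root and the subtrees at the children of its root. -/
noncomputable def subtreeIso (hr : IsTree r) (u : V) :
    AddRoot (fun c : {c // IsChild r u c} => Subrel r (r c)) ≃r Subrel r (r u) := by
  let f : Option (Σ c : {c // IsChild r u c}, {z // r c z}) → {y // r u y} := fun o =>
    o.elim ⟨u, hr.refl u⟩ fun z => ⟨z.2.1, hr.trans _ _ _ z.1.2.1 z.2.2⟩
  have hroot (z : Σ c : {c // IsChild r u c}, {z // r c z}) : ¬ r z.2 u := fun h =>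
    (hr.nUp_lt_of_isChild z.1.2).ne
      (congrArg _ (hr.antisymm _ _ z.1.2.1 (hr.trans _ _ _ z.2.2 h)))
  have hf (x y) : r (f x) (f y) ↔ AddRoot (fun c : {c // IsChild r u c} => Subrel r (r c)) x y := by
    rcases x with _ | ⟨⟨c, hc⟩, z, hz⟩
    · exact iff_of_true (f y).2 (.root y)
    rcases y with _ | ⟨⟨c', hc'⟩, z', hz'⟩
    · exact iff_of_false (hroot ⟨⟨c, hc⟩, z, hz⟩) nofun
    refine ⟨fun h => ?_, fun h => by cases h; assumption⟩
    obtain rfl := hr.isChild_unique hc hc' (hr.trans _ _ _ hz h) hz'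
    exact .branch h
  refine ⟨Equiv.ofBijective f ⟨fun x y h => ?_, fun ⟨y, hy⟩ => ?_⟩, hf _ _⟩
  · have hxy := (hf x y).1 (h ▸ hr.refl _)
    have hyx := (hf y x).1 (h ▸ hr.refl _)
    cases hxy with
    | root => cases hyx; rfl
    | @branch c z z' _ =>
      have hz : (f (some ⟨c, z⟩)).1 = (f (some ⟨c, z'⟩)).1 := congrArg Subtype.val h
      obtain rfl : z = z' := Subtype.ext hz
      rfl
  · by_cases hne : u = y
    · exact ⟨none, Subtype.ext hne⟩
    · obtain ⟨c, hc, hcy⟩ := hr.exists_isChild hy hne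
      exact ⟨some ⟨⟨c, hc⟩, y, hcy⟩, rfl⟩

theorem nonempty_subrel_iso (hr : IsTree r) (hs : IsTree s) {v : W}
    (e : {c // IsChild r u c} ≃ {c // IsChild s v c})
    (h : ∀ c : {c // IsChild r u c}, Nonempty (Subrel r (r c) ≃r Subrel s (s (e c)))) :
    Nonempty (Subrel r (r u) ≃r Subrel s (s v)) :=
  ⟨(hr.subtreeIso u).symm.trans ((AddRoot.congr e fun c => (h c).some).trans (hs.subtreeIso v))⟩

theorem isChild_of_nUp_le_one (hr : IsTree r) (h : r u y) (hne : u ≠ y)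
    (hy : nUp r y ≤ nUp r u + 1) : IsChild r u y :=
  ⟨h, hy.antisymm ((ENat.add_one_le_iff (hr.nUp_ne_top u)).2 (hr.nUp_lt h hne))⟩

theorem nDown_eq_of_nUp_le_one (hr : IsTree r) (hu : ∀ y, r u y → nUp r y ≤ nUp r u + 1) :
    nDown r u = {c | IsChild r u c}.encard + 1 := by
  have hset : {y | r u y} = insert u {c | IsChild r u c} := by
    refine Set.ext fun y => ⟨fun h => or_iff_not_imp_left.2 fun hne => ?_, ?_⟩
    · exact hr.isChild_of_nUp_le_one h (Ne.symm hne) (hu y h)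
    · rintro (rfl | h)
      exacts [hr.refl y, h.1]
  exact (congrArg Set.encard hset).trans (Set.encard_insert_of_notMem fun h =>
    (hr.nUp_lt_of_isChild h).ne rfl)

/-- If all descendants of `u` are equal to `u`, the subtree at `u` is a single node. -/
def subrelIsoOfLeaf (hr : IsTree r) (hs : IsTree s) {v : W} (hu : ∀ y, r u y → u = y)
    (hv : ∀ y, s v y → v = y) : Subrel r (r u) ≃r Subrel s (s v) where
  toFun _ := ⟨v, hs.refl v⟩
  invFun _ := ⟨u, hr.refl u⟩
  left_inv y := Subtype.ext (hu _ y.2)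
  right_inv y := Subtype.ext (hv _ y.2)
  map_rel_iff' {x y} := iff_of_true (hs.refl v) ((hu _ x.2).subst (motive := (r · y)) y.2)

theorem nUp_le_of_isChild (hr : IsTree r) {n : ℕ} (hc : IsChild r u c)
    (hu : ∀ y, r u y → nUp r y ≤ nUp r u + (n + 1 : ℕ)) (y : V) (hy : r c y) :
    nUp r y ≤ nUp r c + n := by
  rw [hc.2, add_assoc, add_comm 1]
  exact_mod_cast hu y (hr.trans _ _ _ hc.1 hy)

theorem eq_of_isChild_of_nUp_le (hr : IsTree r) (hc : IsChild r u c)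
    (hu : ∀ y, r u y → nUp r y ≤ nUp r u + (0 + 1 : ℕ)) (y : V) (hy : r c y) : c = y := by
  by_contra hne
  exact (hr.nUp_lt hy hne).not_ge (by simpa using hr.nUp_le_of_isChild hc hu y hy)

theorem nonempty_subrel_iso_of_inv_eq [Countable V] [Countable W] (hr : IsTree r) (hs : IsTree s)
    {k : ℕ} {v : W} (hu : ∀ y, r u y → nUp r y ≤ nUp r u + (k + 1 : ℕ))
    (hv : ∀ y, s v y → nUp s y ≤ nUp s v + (k + 1 : ℕ)) (h : inv r k u = inv s k v) :
    Nonempty (Subrel r (r u) ≃r Subrel s (s v)) := by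
  induction k generalizing u v with
  | zero =>
    have hchildren : {c | IsChild r u c}.encard = {c | IsChild s v c}.encard := by
      have h : nDown r u = nDown s v := h
      rw [hr.nDown_eq_of_nUp_le_one (by simpa using hu),
        hs.nDown_eq_of_nUp_le_one (by simpa using hv)] at h
      exact WithTop.add_right_cancel ENat.one_ne_top h
    obtain ⟨e⟩ := nonempty_equiv_of_encard_eq hchildren
    exact hr.nonempty_subrel_iso hs e fun c =>
      ⟨hr.subrelIsoOfLeaf hs (hr.eq_of_isChild_of_nUp_le c.2 hu)
        (hs.eq_of_isChild_of_nUp_le (e c).2 hv)⟩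
  | succ k ih =>
    obtain ⟨e, he⟩ := exists_equiv_preserving (f := fun c : {c // IsChild r u c} => inv r k c)
      (g := fun c : {c // IsChild s v c} => inv s k c) fun t =>
        encard_setOf_subtype.trans ((congrFun h t).trans encard_setOf_subtype.symm)
    exact hr.nonempty_subrel_iso hs e fun c => ih (hr.nUp_le_of_isChild c.2 hu)
      (hs.nUp_le_of_isChild (e c).2 hv) (he c).symm

end IsTree

section TreeOfHeightLE

variable {V W : Type} {r : V → V → Prop} {s : W → W → Prop} {n : ℕ}

/-- A relation is isomorphic to its restriction to a predicate that always holds. -/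
def subrelIso {p : V → Prop} (hp : ∀ x, p x) : Subrel r p ≃r r where
  toEquiv := Equiv.subtypeUnivEquiv hp
  map_rel_iff' := Iff.rfl

theorem nUp_eq_level_add_one {x : V} (h : r x x) : nUp r x = level r x + 1 := by
  rw [level, ← Set.encard_insert_of_notMem (a := x) fun hx => hx.2 rfl]
  refine congrArg Set.encard (Set.ext fun y => ?_)
  by_cases hy : y = x <;> simp [hy, h]

theorem height_le_iff (hr : ∀ x, r x x) : height r ≤ n ↔ ∀ x, nUp r x ≤ n + 1 := by
  simp only [height, iSup_le_iff, nUp_eq_level_add_one (hr _)]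
  exact forall_congr' fun x => (WithTop.add_le_add_iff_right ENat.one_ne_top).symm

theorem IsTree.nUp_eq_one_iff {o : V} (hr : IsTree r) : nUp r o = 1 ↔ ∀ x, r o x := by
  have hroot {o : V} (ho : ∀ x, r o x) : nUp r o = 1 :=
    Set.encard_eq_one.2 ⟨o, Set.ext fun x =>
      ⟨fun h => hr.antisymm _ _ h (ho x), fun h => h ▸ hr.refl o⟩⟩
  refine ⟨fun h => ?_, hroot⟩
  obtain ⟨o', ho'⟩ := hr.root
  by_contra hne
  exact (hr.nUp_lt (ho' o) fun he => hne (he ▸ ho')).ne ((hroot ho').trans h.symm)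

theorem IsTree.eq_of_nUp_eq_one (hr : IsTree r) {x y : V} (hx : nUp r x = 1) (hy : nUp r y = 1) :
    x = y :=
  hr.antisymm _ _ (hr.nUp_eq_one_iff.1 hx y) (hr.nUp_eq_one_iff.1 hy x)

/-- The conditions on the nodes `x`, `y`, `z` that make a nonempty structure a tree of height at
most `n`. The last one says that there is at most one minimal node. -/
def TreeAxioms (n : ℕ) (r : V → V → Prop) (x y z : V) : Prop :=
  (r x x ∧ nUp r x ≤ (n + 1 : ℕ)) ∧ (r x y → r y x → x = y) ∧ (r x y → r y z → r x z) ∧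
    (r y x → r z x → r y z ∨ r z y) ∧ (nUp r x = 1 → nUp r y = 1 → x = y)

theorem treeAxioms_map (f : r ↪r s) (hs : ∀ x y, s x y → x ∈ Set.range f) {x y z : V} :
    TreeAxioms n s (f x) (f y) (f z) ↔ TreeAxioms n r x y z := by
  simp only [TreeAxioms, nUp_map f hs, f.map_rel_iff, f.injective.eq_iff]

theorem treeOfHeightLE_iff :
    TreeOfHeightLE n V r ↔ Nonempty V ∧ ∀ x y z, TreeAxioms n r x y z := by
  constructor
  · rintro ⟨hr, hn⟩
    obtain ⟨o, -⟩ := hr.root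
    exact ⟨⟨o⟩, fun x y z => ⟨⟨hr.refl x, (height_le_iff hr.refl).1 hn x⟩, hr.antisymm x y,
      hr.trans x y z, hr.linear x y z, hr.eq_of_nUp_eq_one⟩⟩
  · rintro ⟨⟨a⟩, h⟩
    let order : PartialOrder V :=
      { le := r
        le_refl := fun x => (h x x x).1.1
        le_trans := fun x y z => (h x y z).2.2.1
        le_antisymm := fun x y => (h x y x).2.1 }
    have hfin (x : V) : {y | r y x}.Finite :=
      Set.encard_ne_top_iff.1 (ne_top_of_le_ne_top (ENat.natCast_ne_top (n + 1)) (h x x x).1.2)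
    have hmin (x : V) : ∃ o, nUp r o = 1 ∧ r o x := by
      obtain ⟨o, ho⟩ := (hfin x).exists_minimal ⟨x, order.le_refl x⟩
      exact ⟨o, Set.encard_eq_one.2 ⟨o, Set.ext fun y =>
        ⟨fun hy => order.le_antisymm _ _ hy (ho.2 (order.le_trans _ _ _ hy ho.1) hy),
          fun hy => hy ▸ order.le_refl o⟩⟩, ho.1⟩
    obtain ⟨o, ho, -⟩ := hmin a
    have hroot (x : V) : r o x := by
      obtain ⟨o', ho', hx⟩ := hmin x
      rwa [(h o o' o).2.2.2.2 ho ho']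
    exact ⟨⟨order.le_refl, order.le_antisymm, order.le_trans, ⟨o, hroot⟩, hfin,
      fun x y z => (h x y z).2.2.2.1⟩, (height_le_iff order.le_refl).2 fun x => (h x x x).1.2⟩

theorem TreeOfHeightLE.of_iso (hs : TreeOfHeightLE n W s) (e : r ≃r s) :
    TreeOfHeightLE n V r := by
  obtain ⟨⟨a⟩, h⟩ := treeOfHeightLE_iff.1 hs
  exact treeOfHeightLE_iff.2 ⟨⟨e.symm a⟩, fun x y z =>
    (treeAxioms_map e.toRelEmbedding fun x _ _ => e.surjective x).1 (h (e x) (e y) (e z))⟩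

theorem treeOfHeightLE_one_iff : TreeOfHeightLE 1 V r ↔
    ∃ o, nUp r o = 1 ∧ ∀ x, r x x ∧ r o x ∧ nUp r x ≤ 2 := by
  constructor
  · rintro ⟨hr, hn⟩
    obtain ⟨o, ho⟩ := hr.root
    exact ⟨o, hr.nUp_eq_one_iff.2 ho, fun x => ⟨hr.refl x, ho x, (height_le_iff hr.refl).1 hn x⟩⟩
  · rintro ⟨o, ho, h⟩
    have hup (x : V) : {y | r y x} = {o, x} := by
      have hsub : {o, x} ⊆ {y | r y x} := Set.pair_subset (h x).2.1 (h x).1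
      refine (((Set.toFinite _).eq_of_subset_of_encard_le hsub) ?_).symm
      by_cases hx : o = x
      · subst hx
        exact ho.trans_le (by simp)
      · exact (h x).2.2.trans_eq (Set.encard_pair hx).symm
    have hrel (x y : V) : r y x ↔ y = o ∨ y = x := Set.ext_iff.1 (hup x) y
    refine ⟨⟨fun x => (h x).1, ?_, ?_, ⟨o, fun x => (h x).2.1⟩, fun x => ?_, ?_⟩,
      (height_le_iff fun x => (h x).1).2 fun x => (h x).2.2⟩
    · grind
    · grind
    · exact hup x ▸ Set.toFinite _
    · grind

theorem TreeOfHeightLE.nonempty_iso_iff [Countable V] [Countable W] {k : ℕ}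
    (hr : TreeOfHeightLE (k + 1) V r) (hs : TreeOfHeightLE (k + 1) W s) :
    Nonempty (r ≃r s) ↔ ∀ u v, nUp r u = 1 → nUp s v = 1 → inv r k u = inv s k v := by
  constructor
  · rintro ⟨e⟩ u v hu hv
    have hrange (x y : W) (_ : s x y) : x ∈ Set.range e ∧ y ∈ Set.range e :=
      ⟨e.surjective x, e.surjective y⟩
    have he : nUp s (e u) = 1 :=
      (nUp_map e.toRelEmbedding (fun x y h => (hrange x y h).1) u).trans hu
    rw [hs.1.eq_of_nUp_eq_one hv he]
    exact (inv_map e.toRelEmbedding hrange k u).symm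
  · intro h
    obtain ⟨u, hu⟩ := hr.1.root
    obtain ⟨v, hv⟩ := hs.1.root
    have hu' := hr.1.nUp_eq_one_iff.2 hu
    have hv' := hs.1.nUp_eq_one_iff.2 hv
    obtain ⟨e⟩ := hr.1.nonempty_subrel_iso_of_inv_eq hs.1
      (fun y _ => by rw [hu', add_comm]; exact (height_le_iff hr.1.refl).1 hr.2 y)
      (fun y _ => by rw [hv', add_comm]; exact (height_le_iff hs.1.refl).1 hs.2 y) (h u v hu' hv')
    exact ⟨((subrelIso hu).symm.trans e).trans (subrelIso hv)⟩

end TreeOfHeightLE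

section InvComplexity

theorem le_encard_iff {V : Type} {S : Set V} {l : ℕ} :
    l ≤ S.encard ↔ ∃ ys : List V, ys.Nodup ∧ ys.length = l ∧ ∀ y ∈ ys, y ∈ S := by
  classical
  constructor
  · intro h
    obtain ⟨F, hF, hFl⟩ := Set.exists_subset_encard_eq h
    have hfin : F.Finite := Set.finite_of_encard_eq_coe hFl
    refine ⟨hfin.toFinset.toList, Finset.nodup_toList _, ?_, fun y hy => hF (by simpa using hy)⟩
    rw [Finset.length_toList]
    rw [hfin.encard_eq_coe_toFinset_card] at hFl
    exact_mod_cast hFl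
  · rintro ⟨ys, hys, rfl, h⟩
    rw [← List.toFinset_card_of_nodup hys, ← Set.encard_coe_eq_coe_finsetCard]
    exact Set.encard_le_encard fun y hy => h y (by simpa using hy)

theorem primrecPred_nodup {V : Type} [Primcodable V] : PrimrecPred fun l : List V => l.Nodup := by
  have hget {f : (List V × ℕ) × ℕ → ℕ} (hf : Primrec f) : Primrec fun x => x.1.1[f x]? :=
    Primrec.list_getElem?.comp (by fun_prop) hf
  refine (primrecPred_forall_mem (l := fun l : List V => List.range l.length)
    (p := fun l j => ∀ i ∈ List.range j, l[i]? ≠ l[j]?) (by fun_prop)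
    (primrecPred_forall_mem (p := fun (x : List V × ℕ) i => x.1[i]? ≠ x.1[x.2]?) (by fun_prop)
      (primrecPred_eq (hget .snd) (hget (by fun_prop))).not)).of_eq fun l => ?_
  simp only [List.nodup_iff_getElem?_ne_getElem?, List.mem_range]
  exact ⟨fun h i j hij hj => h j hj i hij, fun h j hj i hij => h i j hij hj⟩

theorem exists_natCast_le_of_lt {a b : ℕ∞} (h : a < b) : ∃ l : ℕ, l ≤ b ∧ ¬ l ≤ a := by
  lift a to ℕ using h.ne_top
  exact ⟨a + 1, by exact_mod_cast Order.add_one_le_of_lt h, by norm_cast; omega⟩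

/-- It suffices to compare the invariants of two trees at invariants of nodes of these trees, since
all other values are zero. -/
theorem inv_ne_iff {V : Type} {r s : V → V → Prop} {k : ℕ} {u v : V} :
    inv r (k + 1) u ≠ inv s (k + 1) v ↔ ∃ (w : V) (l : ℕ),
      (l ≤ inv r (k + 1) u (inv r k w) ∧ ¬ l ≤ inv s (k + 1) v (inv r k w)) ∨
        l ≤ inv s (k + 1) v (inv s k w) ∧ ¬ l ≤ inv r (k + 1) u (inv s k w) := by
  have hlt {r s : V → V → Prop} {u v : V} {t : Inv k} (h : inv s (k + 1) v t < inv r (k + 1) u t) :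
      ∃ (w : V) (l : ℕ), l ≤ inv r (k + 1) u (inv r k w) ∧ ¬ l ≤ inv s (k + 1) v (inv r k w) := by
    obtain ⟨w, -, rfl⟩ := Set.encard_ne_zero.1 (pos_of_gt h).ne'
    exact ⟨w, exists_natCast_le_of_lt h⟩
  constructor
  · intro hne
    obtain ⟨t, ht⟩ := Function.ne_iff.1 hne
    rcases lt_or_gt_of_ne ht with h | h
    · exact (hlt h).imp fun _ => .imp fun _ => .inr
    · exact (hlt h).imp fun _ => .imp fun _ => .inl
  · rintro ⟨w, l, h | h⟩ heq
    · exact h.2 (heq ▸ h.1)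
    · exact h.2 (heq ▸ h.1)

variable {α V : Type} [Primcodable α] [Primcodable V] {r : α → V → V → Prop} {k m : ℕ}

theorem sigmaPred_le_inv [Inhabited V]
    (hchild : PrimrecPred fun x : (α × V) × V => IsChild (r x.1.1) x.1.2 x.2)
    (hinv : SigmaPred (m + 1) fun x : (α × V) × α × V =>
      inv (r x.1.1) k x.1.2 ≠ inv (r x.2.1) k x.2.2) :
    SigmaPred (m + 2) fun x : ((α × V) × α × V) × ℕ =>
      x.2 ≤ inv (r x.1.1.1) (k + 1) x.1.1.2 (inv (r x.1.2.1) k x.1.2.2) := by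
  have hlist : PrimrecPred fun x : (((α × V) × α × V) × ℕ) × List V =>
      x.2.Nodup ∧ x.2.length = x.1.2 ∧ ∀ y ∈ x.2, IsChild (r x.1.1.1.1) x.1.1.1.2 y :=
    (primrecPred_nodup.comp .snd).and ((primrecPred_eq (by fun_prop) (by fun_prop)).and
      (primrecPred_forall_mem .snd (hchild.comp (f := fun x :
        ((((α × V) × α × V) × ℕ) × List V) × V => (x.1.1.1.1, x.2)) (by fun_prop))))
  have hmem : PrimrecPred fun x : ((((α × V) × α × V) × ℕ) × List V) × V => x.2 ∈ x.1.2 := by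
    fun_prop
  have hne := SigmaPred.exists_of ((SigmaPred.of_primrecPred hmem).and (hinv.comp
    (f := fun x : ((((α × V) × α × V) × ℕ) × List V) × V => ((x.1.1.1.1.1, x.2), x.1.1.1.2))
    (by fun_prop)))
  have h := SigmaPred.exists_of (SigmaPred.of_not (((SigmaPred.of_primrecPred hlist.not).or
    hne).of_eq fun x => not_not.symm))
  refine h.of_eq fun x => Iff.trans (exists_congr fun ys => ?_) le_encard_iff.symm
  push Not
  rw [and_assoc, and_assoc, ← forall₂_and]
  rfl

theorem sigmaPred_inv_ne_of_primrecPred_isChild [Inhabited V]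
    (hchild : PrimrecPred fun x : (α × V) × V => IsChild (r x.1.1) x.1.2 x.2)
    (hinv : SigmaPred 1 fun x : (α × V) × α × V =>
      inv (r x.1.1) 1 x.1.2 ≠ inv (r x.2.1) 1 x.2.2) (j : ℕ) :
    SigmaPred (2 * j + 1) fun x : (α × V) × α × V =>
      inv (r x.1.1) (j + 1) x.1.2 ≠ inv (r x.2.1) (j + 1) x.2.2 := by
  induction j with
  | zero => exact hinv
  | succ j ih =>
    have hle := sigmaPred_le_inv hchild ih
    have hsep (f : (((α × V) × α × V) × V) × ℕ → (α × V) × α × V) (hf : Primrec f) :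
        SigmaPred (2 * (j + 1) + 1) fun x : (((α × V) × α × V) × V) × ℕ =>
          x.2 ≤ inv (r (f x).1.1) (j + 2) (f x).1.2 (inv (r (f x).1.1) (j + 1) x.1.2) ∧
            ¬ x.2 ≤ inv (r (f x).2.1) (j + 2) (f x).2.2 (inv (r (f x).1.1) (j + 1) x.1.2) :=
      .and (hle.comp (f := fun x => (((f x).1, (f x).1.1, x.1.2), x.2)) (by fun_prop)).succ
        (.of_not ((hle.comp (f := fun x => (((f x).2, (f x).1.1, x.1.2), x.2))
          (by fun_prop)).of_eq fun x => not_not.symm))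
    have h := (hsep (fun x => x.1.1) (by fun_prop)).or
      (hsep (fun x => (x.1.1.2, x.1.1.1)) (by fun_prop))
    exact h.exists_of.exists_of.of_eq fun x =>
      (inv_ne_iff (r := r x.1.1) (s := r x.2.1) (k := j + 1) (u := x.1.2) (v := x.2.2)).symm

end InvComplexity

/-! ### Automatic presentations -/

theorem regularFamily_convs {α : Type} [Primcodable α] :
    RegularFamily fun (_ : α) w => w ∈ convs where
  primrecPred := by
    have hfst : Primrec fun w : List (Option ℕ × Option ℕ) => w.filterMap Prod.fst :=
      Primrec.listFilterMap .id (Primrec.fst.comp .snd).to₂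
    have hsnd : Primrec fun w : List (Option ℕ × Option ℕ) => w.filterMap Prod.snd :=
      Primrec.listFilterMap .id (Primrec.snd.comp .snd).to₂
    exact primrecPred_eq (primrec_conv.comp ((hfst.comp .snd).pair (hsnd.comp .snd))) .snd
  fewQuotients := ⟨_, .const _, fun _ => fewQuotients_convs⟩

namespace Presentation

variable {α : Type} [Primcodable α] {P : Presentation}

theorem primrec_dom : Primrec Presentation.dom :=
  Primrec.fst.comp (Primrec.of_equiv (e := Presentation.equivProd))

theorem primrec_rel : Primrec Presentation.rel :=
  Primrec.snd.comp (Primrec.of_equiv (e := Presentation.equivProd))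

/-- The relation on all words recognized by the second automaton of a presentation. It is decided
uniformly in all presentations, whether or not they are automatic. -/
def WordRel (P : Presentation) (u v : List ℕ) : Prop := conv u v ∈ P.rel.language

@[fun_prop]
theorem primrecPred_mem_dom {f : α → Presentation} {g : α → List ℕ} (hf : Primrec f)
    (hg : Primrec g) : PrimrecPred fun a => g a ∈ (f a).dom.language :=
  FinAut.primrecPred_mem_language.comp ((primrec_dom.comp hf).pair hg)

@[fun_prop]
theorem primrecPred_wordRel {f : α → Presentation} {g h : α → List ℕ} (hf : Primrec f)
    (hg : Primrec g) (hh : Primrec h) : PrimrecPred fun a => (f a).WordRel (g a) (h a) :=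
  FinAut.primrecPred_mem_language.comp
    ((primrec_rel.comp hf).pair (primrec_conv.comp (hg.pair hh)))

theorem regularFamily_dom : RegularFamily fun (P : Presentation) w => w ∈ P.dom.language :=
  FinAut.regularFamily_language.comp primrec_dom

theorem lettersBounded_dom : LettersBounded fun (P : Presentation) w => w ∈ P.dom.language :=
  FinAut.lettersBounded_language.comp primrec_dom

/-- The set of convolutions accepted by the second automaton of a presentation. -/
def acceptedConvs (P : Presentation) : Set (List (Option ℕ × Option ℕ)) :=
  {w | w ∈ P.rel.language} ∩ convs

theorem regularFamily_acceptedConvs :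
    RegularFamily fun (P : Presentation) w => w ∈ P.acceptedConvs :=
  (FinAut.regularFamily_language.comp primrec_rel).and regularFamily_convs

theorem lettersBounded_acceptedConvs :
    LettersBounded fun (P : Presentation) w => w ∈ P.acceptedConvs :=
  (FinAut.lettersBounded_language.comp primrec_rel).mono fun _ _ h => h.1

theorem encard_fiber_snd (P : Presentation) (v : List ℕ) :
    (fiber P.acceptedConvs Prod.snd 0 v).encard = nUp P.WordRel v := by
  rw [acceptedConvs, fiber_convs_snd, (conv_left_injective v).encard_image]
  rfl

theorem encard_fiber_fst (P : Presentation) (u : List ℕ) :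
    (fiber P.acceptedConvs Prod.fst 0 u).encard = nDown P.WordRel u := by
  rw [acceptedConvs, fiber_convs_fst, (conv_right_injective u).encard_image]
  rfl

@[fun_prop]
theorem primrec_nUp {f : α → Presentation} {g : α → List ℕ} (hf : Primrec f) (hg : Primrec g) :
    Primrec fun a => nUp (f a).WordRel (g a) :=
  ((regularFamily_acceptedConvs.primrec_encard_fiber lettersBounded_acceptedConvs .snd).comp
    (hf.pair hg)).of_eq fun a => encard_fiber_snd (f a) (g a)

theorem regularFamily_nUp_eq :
    RegularFamily fun (x : Presentation × ℕ∞) y => nUp x.1.WordRel y = x.2 := by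
  simpa only [← encard_fiber_snd, Set.ofPred_mem_eq] using
    regularFamily_acceptedConvs.encard_fiber_eq lettersBounded_acceptedConvs .snd

theorem regularFamily_nDown_eq :
    RegularFamily fun (x : Presentation × ℕ∞) y => nDown x.1.WordRel y = x.2 := by
  simpa only [← encard_fiber_fst, Set.ofPred_mem_eq] using
    regularFamily_acceptedConvs.encard_fiber_eq lettersBounded_acceptedConvs .fst

theorem regularFamily_nUp_le (n : ℕ) :
    RegularFamily fun (P : Presentation) y => nUp P.WordRel y ≤ n where
  primrecPred := primrecPred_le_natCast (by fun_prop) (.const n)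
  fewQuotients := by
    obtain ⟨N, hN, h⟩ := regularFamily_acceptedConvs.fewQuotients
    refine ⟨fun P => (n + 1 + 1) ^ N P, by fun_prop, fun P => ?_⟩
    have hset : {y | nUp P.WordRel y ≤ n} =
        {y | ((n + 1 : ℕ) : ℕ∞) ≤ (fiber P.acceptedConvs Prod.snd 0 y).encard}ᶜ := by
      ext y
      simp [encard_fiber_snd, ENat.add_one_le_iff (ENat.natCast_ne_top n)]
    rw [hset]
    exact ((h P).le_encard_fiber (n + 1)).compl

theorem regularFamily_wordRel :
    RegularFamily fun (x : Presentation × List ℕ) y => x.1.WordRel x.2 y where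
  primrecPred := by fun_prop
  fewQuotients := by
    obtain ⟨N, hN, h⟩ := (FinAut.regularFamily_language.comp primrec_rel).fewQuotients
    exact ⟨fun x => (x.2.length + 1) * N x.1, by fun_prop, fun x => (h x.1).conv_left x.2⟩

theorem lettersBounded_wordRel :
    LettersBounded fun (x : Presentation × List ℕ) y => x.1.WordRel x.2 y := by
  obtain ⟨B, hB, h⟩ := FinAut.lettersBounded_language.comp primrec_rel
  refine ⟨fun x => B x.1, by fun_prop, fun x y hy a ha => ?_⟩
  obtain ⟨o, ho⟩ := mem_conv_of_mem_right (u := x.2) ha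
  calc Encodable.encode a ≤ Encodable.encode (some a) := Nat.le_succ _
    _ ≤ Encodable.encode (o, some a) := Nat.right_le_pair _ _
    _ ≤ B x.1 := h x.1 _ hy _ ho

theorem regularFamily_wordRel_self :
    RegularFamily fun (P : Presentation) y => P.WordRel y y := by
  have hconv (y : List ℕ) : conv y y = y.map fun a => (some a, some a) :=
    List.ext_getElem? fun i => by by_cases hi : i < y.length <;> simp [conv, hi]
  simpa only [WordRel, hconv] using
    (FinAut.regularFamily_language.comp primrec_rel).preimage
      (φ := List.map fun a : ℕ => (some a, some a)) (Primrec.list_map .id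
        ((Primrec.option_some.pair Primrec.option_some).comp .snd).to₂) fun _ _ => List.map_append

theorem primrecPred_isAutomatic : PrimrecPred Presentation.IsAutomatic := by
  have hdom {π : Option ℕ × Option ℕ → Option ℕ} (hπ : Primrec π) :
      RegularFamily fun (P : Presentation) w => w.filterMap π ∈ P.dom.language :=
    regularFamily_dom.preimage (Primrec.listFilterMap .id (hπ.comp .snd).to₂)
      fun _ _ => List.filterMap_append
  have hbad : RegularFamily fun (P : Presentation) w => w ∈ P.rel.language ∧
      ¬ (w ∈ convs ∧ w.filterMap Prod.fst ∈ P.dom.language ∧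
        w.filterMap Prod.snd ∈ P.dom.language) :=
    (FinAut.regularFamily_language.comp primrec_rel).and
      (regularFamily_convs.and ((hdom .fst).and (hdom .snd))).not
  refine (hbad.primrecPred_exists ((FinAut.lettersBounded_language.comp primrec_rel).mono
    fun _ _ h => h.1)).not.of_eq fun P => ?_
  push Not
  refine forall₂_congr fun w _ => ⟨fun ⟨hw, h⟩ => ⟨_, h.1, _, h.2, hw.symm⟩, ?_⟩
  rintro ⟨u, hu, v, hv, rfl⟩
  rw [filterMap_fst_conv, filterMap_snd_conv]
  exact ⟨conv_mem_convs u v, hu, hv⟩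

theorem primrecPred_isChild : PrimrecPred fun x : (Presentation × List ℕ) × List ℕ =>
    IsChild x.1.1.WordRel x.1.2 x.2 := by
  unfold IsChild
  fun_prop

theorem primrec_encard_children : Primrec fun x : (Presentation × List ℕ) × ℕ∞ =>
    {y | IsChild x.1.1.WordRel x.1.2 y ∧ nDown x.1.1.WordRel y = x.2}.encard := by
  have hchild : RegularFamily fun (x : Presentation × List ℕ) y => IsChild x.1.WordRel x.2 y :=
    regularFamily_wordRel.and (regularFamily_nUp_eq.comp
      (f := fun x : Presentation × List ℕ => (x.1, nUp x.1.WordRel x.2 + 1)) (by fun_prop))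
  exact ((hchild.comp .fst).and (regularFamily_nDown_eq.comp
    (f := fun x : (Presentation × List ℕ) × ℕ∞ => (x.1.1, x.2)) (by fun_prop))).primrec_encard
    ((lettersBounded_wordRel.comp .fst).mono fun _ _ h => h.1.1)

theorem sigmaPred_inv_ne (j : ℕ) :
    SigmaPred (2 * j + 1) fun x : (Presentation × List ℕ) × Presentation × List ℕ =>
      inv x.1.1.WordRel (j + 1) x.1.2 ≠ inv x.2.1.WordRel (j + 1) x.2.2 := by
  refine sigmaPred_inv_ne_of_primrecPred_isChild primrecPred_isChild ?_ j
  have hcount {f : ((Presentation × List ℕ) × Presentation × List ℕ) × ℕ∞ →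
      (Presentation × List ℕ) × ℕ∞} (hf : Primrec f) := primrec_encard_children.comp hf
  refine (SigmaPred.exists_of (SigmaPred.of_primrecPred (primrecPred_eq
    (hcount (f := fun x => (x.1.1, x.2)) (by fun_prop))
    (hcount (f := fun x => (x.1.2, x.2)) (by fun_prop))).not)).of_eq fun x => ?_
  exact Function.ne_iff.symm

end Presentation

namespace Presentation

variable {P Q : Presentation} {k n : ℕ}

instance : Countable P.Dom := inferInstanceAs (Countable {w // w ∈ P.dom.language})

/-- The structure presented by `P` as a substructure of the set of all words. -/
def relEmbedding (P : Presentation) : P.Rel ↪r P.WordRel where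
  toFun := Subtype.val
  inj' := Subtype.val_injective
  map_rel_iff' := Iff.rfl

namespace IsAutomatic

theorem mem_dom (hP : P.IsAutomatic) {u v : List ℕ} (h : P.WordRel u v) :
    u ∈ P.dom.language ∧ v ∈ P.dom.language := by
  obtain ⟨u', hu, v', hv, hw⟩ := hP _ h
  have hu' := congrArg (List.filterMap Prod.fst) hw
  have hv' := congrArg (List.filterMap Prod.snd) hw
  rw [filterMap_fst_conv, filterMap_fst_conv] at hu'
  rw [filterMap_snd_conv, filterMap_snd_conv] at hv'
  exact ⟨hu' ▸ hu, hv' ▸ hv⟩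

theorem mem_dom_of_nUp_eq_one (hP : P.IsAutomatic) {u : List ℕ} (hu : nUp P.WordRel u = 1) :
    u ∈ P.dom.language := by
  obtain ⟨x, hx⟩ := Set.encard_ne_zero.1 (hu.trans_ne one_ne_zero)
  exact (hP.mem_dom hx).2

theorem nUp_wordRel (hP : P.IsAutomatic) (u : P.Dom) : nUp P.WordRel u.1 = nUp P.Rel u :=
  nUp_map P.relEmbedding (fun _ _ h => ⟨⟨_, (hP.mem_dom h).1⟩, rfl⟩) u

theorem inv_wordRel (hP : P.IsAutomatic) (u : P.Dom) : inv P.WordRel k u.1 = inv P.Rel k u :=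
  inv_map P.relEmbedding (fun _ _ h => ⟨⟨⟨_, (hP.mem_dom h).1⟩, rfl⟩,
    ⟨⟨_, (hP.mem_dom h).2⟩, rfl⟩⟩) k u

theorem treeOfHeightLE_iff (hP : P.IsAutomatic) : TreeOfHeightLE n P.Dom P.Rel ↔
    (∃ w, w ∈ P.dom.language) ∧ ∀ x : List ℕ × List ℕ × List ℕ, x.1 ∈ P.dom.language →
      x.2.1 ∈ P.dom.language → x.2.2 ∈ P.dom.language →
      TreeAxioms n P.WordRel x.1 x.2.1 x.2.2 := by
  have hmap {x y z : P.Dom} : TreeAxioms n P.WordRel x.1 y.1 z.1 ↔ TreeAxioms n P.Rel x y z :=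
    treeAxioms_map P.relEmbedding fun _ _ h => ⟨⟨_, (hP.mem_dom h).1⟩, rfl⟩
  rw [AutomaticTrees.treeOfHeightLE_iff]
  exact and_congr nonempty_subtype
    ⟨fun h x hx hy hz => hmap.2 (h ⟨x.1, hx⟩ ⟨x.2.1, hy⟩ ⟨x.2.2, hz⟩),
      fun h x y z => hmap.1 (h (x.1, y.1, z.1) x.2 y.2 z.2)⟩

theorem treeOfHeightLE_one_iff (hP : P.IsAutomatic) : TreeOfHeightLE 1 P.Dom P.Rel ↔
    {o | o ∈ P.dom.language ∧ nUp P.WordRel o = 1}.Finite ∧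
      ∃ o, (o ∈ P.dom.language ∧ nUp P.WordRel o = 1) ∧ ¬ ∃ y, y ∈ P.dom.language ∧
        ¬ ((P.WordRel y y ∧ P.WordRel o y) ∧ nUp P.WordRel y ≤ (2 : ℕ)) := by
  constructor
  · intro h
    have hunique : {o | o ∈ P.dom.language ∧ nUp P.WordRel o = 1}.Subsingleton := by
      rintro x ⟨hx, hx1⟩ y ⟨hy, hy1⟩
      exact congrArg Subtype.val (h.1.eq_of_nUp_eq_one (x := ⟨x, hx⟩) (y := ⟨y, hy⟩)
        ((hP.nUp_wordRel _).symm.trans hx1) ((hP.nUp_wordRel _).symm.trans hy1))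
    obtain ⟨o, ho, hstar⟩ := AutomaticTrees.treeOfHeightLE_one_iff.1 h
    refine ⟨hunique.finite, o.1, ⟨o.2, (hP.nUp_wordRel o).trans ho⟩, fun ⟨y, hy, hne⟩ => hne ?_⟩
    obtain ⟨hrefl, hroot, hup⟩ := hstar ⟨y, hy⟩
    exact ⟨⟨hrefl, hroot⟩, (hP.nUp_wordRel ⟨y, hy⟩).trans_le hup⟩
  · rintro ⟨-, o, ⟨ho, ho1⟩, hstar⟩
    refine AutomaticTrees.treeOfHeightLE_one_iff.2
      ⟨⟨o, ho⟩, (hP.nUp_wordRel _).symm.trans ho1, fun y => ?_⟩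
    obtain ⟨⟨hrefl, hroot⟩, hup⟩ := not_not.1 fun hne => hstar ⟨y.1, y.2, hne⟩
    exact ⟨hrefl, hroot, (hP.nUp_wordRel y).symm.trans_le hup⟩

theorem mem_isoProblem_iff (hP : P.IsAutomatic) (hQ : Q.IsAutomatic) :
    (P, Q) ∈ isoProblem (TreeOfHeightLE (k + 1)) ↔
      TreeOfHeightLE (k + 1) P.Dom P.Rel ∧ TreeOfHeightLE (k + 1) Q.Dom Q.Rel ∧
        ∀ u v, nUp P.WordRel u = 1 → nUp Q.WordRel v = 1 →
          inv P.WordRel k u = inv Q.WordRel k v := by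
  have hinv : (∀ u v, nUp P.WordRel u = 1 → nUp Q.WordRel v = 1 →
      inv P.WordRel k u = inv Q.WordRel k v) ↔
      ∀ u v, nUp P.Rel u = 1 → nUp Q.Rel v = 1 → inv P.Rel k u = inv Q.Rel k v := by
    simp only [← hP.nUp_wordRel, ← hQ.nUp_wordRel, ← hP.inv_wordRel, ← hQ.inv_wordRel]
    exact ⟨fun h u v => h u.1 v.1, fun h u v hu hv =>
      h ⟨u, hP.mem_dom_of_nUp_eq_one hu⟩ ⟨v, hQ.mem_dom_of_nUp_eq_one hv⟩ hu hv⟩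
  rw [hinv]
  constructor
  · rintro ⟨-, -, ⟨e⟩, htree⟩
    have htree' := htree.of_iso e
    exact ⟨htree', htree, (htree'.nonempty_iso_iff htree).1 ⟨e⟩⟩
  · rintro ⟨hTP, hTQ, h⟩
    exact ⟨hP, hQ, (hTP.nonempty_iso_iff hTQ).2 h, hTQ⟩

theorem mem_isoProblem_one_iff (hP : P.IsAutomatic) (hQ : Q.IsAutomatic) :
    (P, Q) ∈ isoProblem (TreeOfHeightLE 1) ↔
      TreeOfHeightLE 1 P.Dom P.Rel ∧ TreeOfHeightLE 1 Q.Dom Q.Rel ∧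
        {w | w ∈ P.dom.language}.encard = {w | w ∈ Q.dom.language}.encard := by
  have hdom {P : Presentation} (hP : P.IsAutomatic) (hT : TreeOfHeightLE 1 P.Dom P.Rel)
      {u : List ℕ} (hu : nUp P.WordRel u = 1) :
      inv P.WordRel 0 u = {w | w ∈ P.dom.language}.encard := by
    have hu' : u ∈ P.dom.language := hP.mem_dom_of_nUp_eq_one hu
    have hroot := hT.1.nUp_eq_one_iff.1 ((hP.nUp_wordRel ⟨u, hu'⟩).symm.trans hu)
    exact congrArg Set.encard (Set.ext fun w => ⟨fun h => (hP.mem_dom h).2, fun h => hroot ⟨w, h⟩⟩)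
  have hroot {P : Presentation} (hP : P.IsAutomatic) (hT : TreeOfHeightLE 1 P.Dom P.Rel) :
      ∃ u, nUp P.WordRel u = 1 :=
    hT.1.root.elim fun o ho => ⟨o.1, (hP.nUp_wordRel o).trans (hT.1.nUp_eq_one_iff.2 ho)⟩
  rw [hP.mem_isoProblem_iff hQ]
  refine and_congr_right fun hTP => and_congr_right fun hTQ => ?_
  constructor
  · intro h
    obtain ⟨u, hu⟩ := hroot hP hTP
    obtain ⟨v, hv⟩ := hroot hQ hTQ
    exact (hdom hP hTP hu).symm.trans ((h u v hu hv).trans (hdom hQ hTQ hv))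
  · exact fun h u v hu hv => (hdom hP hTP hu).trans (h.trans (hdom hQ hTQ hv).symm)

end IsAutomatic

theorem primrecPred_treeOfHeightLE_one : PrimrecPred fun P : Presentation =>
    P.IsAutomatic ∧ TreeOfHeightLE 1 P.Dom P.Rel := by
  have hroot : RegularFamily fun (P : Presentation) o =>
      o ∈ P.dom.language ∧ nUp P.WordRel o = 1 :=
    regularFamily_dom.and (regularFamily_nUp_eq.comp
      (f := fun P : Presentation => (P, (1 : ℕ∞))) (by fun_prop))
  have hbad : RegularFamily fun (x : Presentation × List ℕ) y => y ∈ x.1.dom.language ∧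
      ¬ ((x.1.WordRel y y ∧ x.1.WordRel x.2 y) ∧ nUp x.1.WordRel y ≤ (2 : ℕ)) :=
    (regularFamily_dom.comp .fst).and (((regularFamily_wordRel_self.comp .fst).and
      regularFamily_wordRel).and ((regularFamily_nUp_le 2).comp .fst)).not
  have hstar := (hbad.primrecPred_exists
    ((lettersBounded_dom.comp .fst).mono fun _ _ h => h.1)).not
  exact (primrecPred_isAutomatic.and (hroot.primrecPred_finite_and_exists
    (lettersBounded_dom.mono fun _ _ h => h.1) hstar)).of_eq fun P =>
      and_congr_right fun hP => hP.treeOfHeightLE_one_iff.symm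

theorem isDecidable_isoProblem : IsDecidable (isoProblem (TreeOfHeightLE 1)) := by
  have hcard := regularFamily_dom.primrec_encard lettersBounded_dom
  refine (((primrecPred_treeOfHeightLE_one.comp .fst).and
    (primrecPred_treeOfHeightLE_one.comp .snd)).and
    (primrecPred_eq (hcard.comp .fst) (hcard.comp .snd))).computablePred.of_eq fun x => ?_
  constructor
  · rintro ⟨⟨⟨hP, hTP⟩, hQ, hTQ⟩, h⟩
    exact (hP.mem_isoProblem_one_iff hQ).2 ⟨hTP, hTQ, h⟩
  · intro h
    obtain ⟨hTP, hTQ, hcard⟩ := (h.1.mem_isoProblem_one_iff h.2.1).1 h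
    exact ⟨⟨⟨h.1, hTP⟩, h.2.1, hTQ⟩, hcard⟩

theorem primrecPred_treeAxioms (n : ℕ) :
    PrimrecPred fun x : Presentation × List ℕ × List ℕ × List ℕ =>
      TreeAxioms n x.1.WordRel x.2.1 x.2.2.1 x.2.2.2 := by
  have hle : PrimrecPred fun x : Presentation × List ℕ × List ℕ × List ℕ =>
      nUp x.1.WordRel x.2.1 ≤ (n + 1 : ℕ) := primrecPred_le_natCast (by fun_prop) (.const _)
  unfold TreeAxioms
  fun_prop

theorem sigmaPred_not_treeOfHeightLE (n : ℕ) : SigmaPred 1 fun P : Presentation =>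
    ¬ (P.IsAutomatic ∧ TreeOfHeightLE n P.Dom P.Rel) := by
  have hex : PrimrecPred fun P : Presentation => ∃ w, w ∈ P.dom.language :=
    regularFamily_dom.primrecPred_exists lettersBounded_dom
  have hforall : PrimrecPred fun x : Presentation × List ℕ × List ℕ × List ℕ =>
      x.2.1 ∈ x.1.dom.language → x.2.2.1 ∈ x.1.dom.language → x.2.2.2 ∈ x.1.dom.language →
        TreeAxioms n x.1.WordRel x.2.1 x.2.2.1 x.2.2.2 := by
    have htree := primrecPred_treeAxioms n
    fun_prop
  refine ((SigmaPred.of_primrecPred (primrecPred_isAutomatic.and hex).not).or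
    (SigmaPred.of_not_forall (p := fun (P : Presentation) (x : List ℕ × List ℕ × List ℕ) =>
      x.1 ∈ P.dom.language → x.2.1 ∈ P.dom.language → x.2.2 ∈ P.dom.language →
        TreeAxioms n P.WordRel x.1 x.2.1 x.2.2) hforall)).of_eq fun P => ?_
  rw [← not_and_or, and_assoc]
  exact not_congr (and_congr_right fun hP => hP.treeOfHeightLE_iff.symm)

theorem isPi_isoProblem (j : ℕ) : IsPi (2 * j + 1) (isoProblem (TreeOfHeightLE (j + 2))) := by
  have htree : SigmaPred (2 * j + 1) fun P : Presentation =>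
      ¬ (P.IsAutomatic ∧ TreeOfHeightLE (j + 2) P.Dom P.Rel) :=
    (sigmaPred_not_treeOfHeightLE (j + 2)).mono (by omega)
  have hroot : SigmaPred (2 * j + 1) fun x : (Presentation × Presentation) × List ℕ × List ℕ =>
      nUp x.1.1.WordRel x.2.1 = 1 ∧ nUp x.1.2.WordRel x.2.2 = 1 :=
    .of_primrecPred (by fun_prop)
  have hne := (sigmaPred_inv_ne j).comp
    (f := fun x : (Presentation × Presentation) × List ℕ × List ℕ =>
      ((x.1.1, x.2.1), x.1.2, x.2.2)) (by fun_prop)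
  refine SigmaPred.isSigma ((((htree.comp .fst).or (htree.comp .snd)).or
    (hroot.and hne).exists_of).of_eq fun x => ?_)
  rw [Set.mem_compl_iff, ← not_and_or, ← not_forall_not, ← not_and_or, not_iff_not]
  constructor
  · rintro ⟨⟨⟨hP, hTP⟩, hQ, hTQ⟩, h⟩
    exact (hP.mem_isoProblem_iff hQ).2 ⟨hTP, hTQ, fun u v hu hv =>
      not_not.1 fun hne => h (u, v) ⟨⟨hu, hv⟩, hne⟩⟩
  · intro h
    obtain ⟨hTP, hTQ, heq⟩ := (h.1.mem_isoProblem_iff h.2.1).1 h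
    exact ⟨⟨⟨h.1, hTP⟩, h.2.1, hTQ⟩, fun y hy => hy.2 (heq _ _ hy.1.1 hy.1.2)⟩

end Presentation

end AutomaticTrees

theorem proposition4p2 :
    AutomaticTrees.IsDecidable (AutomaticTrees.isoProblem (AutomaticTrees.TreeOfHeightLE 1)) ∧
    ∀ n : ℕ, 2 ≤ n →
      AutomaticTrees.IsPi (2 * n - 3)
        (AutomaticTrees.isoProblem (AutomaticTrees.TreeOfHeightLE n)) := by
  refine ⟨AutomaticTrees.Presentation.isDecidable_isoProblem, fun n hn => ?_⟩
  obtain ⟨j, rfl⟩ := Nat.exists_eq_add_of_le' hn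
  rw [show 2 * (j + 2) - 3 = 2 * j + 1 by omega]
  exact AutomaticTrees.Presentation.isPi_isoProblem j
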